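/- **Setting.** Let $N\ge 1$. Vectors $z\in\mathbb C^N$ are rows, $|z|$ is the standard Hermitian norm, and $dL$ is Lebesgue measure (product of the $dx_j\,dy_j$ in unitary coordinates; on a zero-dimensional space it is the unit point mass). Let $\mathcal D_N$ be the set of complex symmetric $N\times N$ matrices $A$ with $A^*A<I$, and put $Q_A(z)=zAz^T$. For a finite-dimensional complex Hermitian space $\mathcal H$, let $\mathcal D(\mathcal H)$ be the set of complex quadratic forms $Q:\mathcal H\to\mathbb C$ with $e^{Q/2}e^{-\|\cdot\|^2/2}\in L^2(\mathcal H)$. For $k\in\mathbb N$, $A\in\mathcal D_N$ and $w\in\mathbb C^N$ with $|w|=1$, let $$\psi_{A,w}(z)=e^{kQ_A(z-w)/2}\,e^{kz\overline w^T}\,e^{-k|w|^2/2}\,e^{-k|z|^2/2},\qquad \Psi_{A,w}(z)=\mathcal R_k(\psi_{A,w})(z)=\frac1{2\pi}\int_0^{2\pi}e^{-ikt}\,\psi_{A,w}(e^{it}z)\,dt\quad(z\in\mathbb C^N).$$ Restricted to $S^{2N-1}=\{|z|=1\}$ this is the reduced state. Since $\Psi_{A,w}(e^{i\theta}z)=e^{ik\theta}\Psi_{A,w}(z)$,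 it defines the section $\pi(z)\mapsto[(z,\Psi_{A,w}(z))]_k$ of the Hermitian line bundle $\mathcal L^k=(S^{2N-1}\times\mathbb C)/{\sim_k}\to\mathbb{CP}^{N-1}$, where $(e^{i\theta}z,\lambda)\sim_k(z,e^{-ik\theta}\lambda)$ and $|[(z,\lambda)]_k|=|\lambda|$, and $\pi:S^{2N-1}\to\mathbb{CP}^{N-1}$ is the Hopf fibration. The micro-support (semi-classical wave-front set) of a sequence of states is the complement of the set of points having a neighbourhood on which the pointwise norm of the $k$-th state is uniformly $O(k^{-M})$ as $k\to\infty$, for every $M$. Let $\mathcal H_w=(\mathbb Cw)^\perp$ be the Hermitian orthogonal complement of $\mathbb C w$. **Theorem 1.2.** Let $A\in\mathcal D_N$ and $|w|=1$. 1. The micro-support of $\Psi_{A,w}$ as $k\to\infty$, as a function on $\mathbb C^N$ and as a function on $S^{2N-1}$, is the $S^1$-orbit $\{e^{it}w:\ t\in[0,2\pi]\}$; as a section of $\mathcal L^k\to\mathbb{CP}^{N-1}$ it is the single point $\pi(w)$. 2. For every $\eta\in\mathcal H_w$ the limit below exists, the integral converges absolutely, and $$\sigma_A(\eta):=\lim_{k\to\infty}\sqrt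 k\,\Psi_{A,w}\bigl(w+\eta/\sqrt k\bigr)=\frac1{2\pi}e^{-|\eta|^2/2}\int_{-\infty}^{\infty}e^{Q_A(isw+\eta)/2}\,e^{-s^2/2}\,ds .$$ Moreover $\operatorname{Re}(Q_A(w)+1)>0$ and there is $Q_{\rho_w(A)}\in\mathcal D(\mathcal H_w)$ such that for all $\eta\in\mathcal H_w$ $$\sigma_A(\eta)=\frac1{\sqrt{2\pi}}\,\frac1{\sqrt{Q_A(w)+1}}\;e^{Q_{\rho_w(A)}(\eta)/2}\,e^{-|\eta|^2/2},$$ with the principal branch of the square root. 3. For every $B\in\mathcal D_N$ the function $\sigma_A\overline{\sigma_B}$ is integrable on $\mathcal H_w$ and, as $k\to\infty$, $$\langle\Psi_{A,w},\Psi_{B,w}\rangle=\frac{2\pi}{k^N}\int_{\mathcal H_w}\sigma_A(\eta)\,\overline{\sigma_B(\eta)}\,dL(\eta)+O(k^{-N-1}),$$ where the inner product is that of $L^2(S^{2N-1})$ for the surface measure of the unit sphere. The constant in $O$ may depend on $A,B,w,N$. -/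

import Mathlib

open Filter Topology MeasureTheory Asymptotics
open scoped ComplexConjugate ComplexOrder Matrix

noncomputable section

namespace ReducedGaussian

/-- `ℂ^N` with its standard Hermitian norm. -/
abbrev Cn (N : ℕ) : Type := EuclideanSpace ℂ (Fin N)

/-- The unit sphere `S^{2N-1}` of `ℂ^N`. -/
abbrev Sph (N : ℕ) : Type := Metric.sphere (0 : Cn N) 1

/-- Lebesgue measure of a finite-dimensional complex inner product space, i.e. the measure for
which the unit cube of an orthonormal basis over `ℝ`, for the real part of the Hermitian product,
has volume one. On `ℂ^n` it is the product of the measures `dx_j dy_j`. -/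
def lebesgue (H : Type*) [NormedAddCommGroup H] [InnerProductSpace ℂ H] [FiniteDimensional ℂ H]
    [MeasurableSpace H] [BorelSpace H] : Measure H :=
  letI : InnerProductSpace ℝ H := InnerProductSpace.rclikeToReal ℂ H
  measureSpaceOfInnerProductSpace.volume

/-- The generalized unit disk `𝒟_N`: complex symmetric matrices with `A^* A < I`. -/
def disk (N : ℕ) : Set (Matrix (Fin N) (Fin N) ℂ) :=
  {A | A.IsSymm ∧ (1 - Aᴴ * A).PosDef}

/-- The coordinate-free disk `𝒟(H)`: complex quadratic forms `Q` on `H` for which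
`e^{Q/2}` times the standard Gaussian `e^{-‖v‖²/2}` is square-integrable. -/
def formDisk (H : Type*) [NormedAddCommGroup H] [InnerProductSpace ℂ H] [FiniteDimensional ℂ H]
    [MeasurableSpace H] [BorelSpace H] : Set (QuadraticForm ℂ H) :=
  {Q | MemLp (fun v : H => Complex.exp (Q v / 2) * Complex.exp (-(‖v‖ : ℂ) ^ 2 / 2)) 2
    (lebesgue H)}

/-- `Q_A(z) = z A z^T`. -/
def quad {N : ℕ} (A : Matrix (Fin N) (Fin N) ℂ) (z : Cn N) : ℂ :=
  ∑ i, ∑ j, z i * A i j * z j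

/-- The Gaussian coherent state
`ψ_{A,w}(z) = e^{k Q_A(z-w)/2} e^{k z w̄^T} e^{-k|w|²/2} e^{-k|z|²/2}`. -/
def coherent {N : ℕ} (k : ℕ) (A : Matrix (Fin N) (Fin N) ℂ) (w z : Cn N) : ℂ :=
  Complex.exp (k * quad A (z - w) / 2) * Complex.exp (k * ∑ i, z i * (starRingEnd ℂ) (w i)) *
    Complex.exp (-k * (‖w‖ : ℂ) ^ 2 / 2) * Complex.exp (-k * (‖z‖ : ℂ) ^ 2 / 2)

/-- The quantum reduction operator, given by averaging over the circle. The formula is used at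
every point of `ℂ^N`; the reduced state proper is its restriction to the unit sphere. -/
def reduction {N : ℕ} (k : ℕ) (ψ : Cn N → ℂ) (z : Cn N) : ℂ :=
  (1 / (2 * Real.pi) : ℂ) * ∫ t in (0 : ℝ)..(2 * Real.pi),
    Complex.exp (-Complex.I * k * t) * ψ (Complex.exp (Complex.I * t) • z)

/-- The reduced state `Ψ_{A,w} = R_k(ψ_{A,w})`. -/
def reducedState {N : ℕ} (k : ℕ) (A : Matrix (Fin N) (Fin N) ℂ) (w : Cn N) : Cn N → ℂ :=
  reduction k (coherent k A w)

/-! ### Projective space and the powers of the hyperplane bundle -/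

/-- The action of `e^{iθ}` on the unit sphere. -/
def rotate {N : ℕ} (θ : ℝ) (z : Sph N) : Sph N :=
  ⟨Complex.exp (Complex.I * θ) • (z : Cn N), by
    have hz : ‖(z : Cn N)‖ = 1 := by simp
    have h : ‖Complex.exp (Complex.I * θ)‖ = 1 := by
      rw [mul_comm]; exact Complex.norm_exp_ofReal_mul_I θ
    simp [norm_smul, h, hz]⟩

/-- The projective space `ℂP^{N-1}`. -/
abbrev CP (N : ℕ) : Type := Projectivization ℂ (Cn N)

/-- The Hopf fibration `π : S^{2N-1} → ℂP^{N-1}`. -/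
def hopf {N : ℕ} (z : Sph N) : CP N :=
  Projectivization.mk ℂ (z : Cn N) (fun h => by
    have hz : ‖(z : Cn N)‖ = 1 := by simp
    simp [h] at hz)

/-- `ℂP^{N-1}` has the quotient topology of the Hopf fibration. -/
instance instTopologicalSpaceCP (N : ℕ) : TopologicalSpace (CP N) :=
  TopologicalSpace.coinduced (hopf (N := N)) inferInstance

/-- The relation `(e^{iθ} z, λ) ∼_k (z, e^{-ikθ} λ)` on `S^{2N-1} × ℂ`. -/
def bundleSetoid (N k : ℕ) : Setoid (Sph N × ℂ) where
  r p q := ∃ θ : ℝ, p.1 = rotate θ q.1 ∧ q.2 = Complex.exp (-Complex.I * k * θ) * p.2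
  iseqv :=
    { refl := fun p => ⟨0, Subtype.ext (by simp [rotate]), by simp⟩
      symm := by
        rintro ⟨z, a⟩ ⟨z', a'⟩ ⟨θ, h1, h2⟩
        dsimp only at h1 h2
        subst h1 h2
        refine ⟨-θ, Subtype.ext ?_, ?_⟩
        · simp [rotate, smul_smul, ← Complex.exp_add]
        · dsimp only
          rw [← mul_assoc, ← Complex.exp_add]
          simp
      trans := by
        rintro ⟨z, a⟩ ⟨z', a'⟩ ⟨z'', a''⟩ ⟨θ, h1, h2⟩ ⟨θ', h3, h4⟩
        dsimp only at h1 h2 h3 h4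
        subst h3 h1 h2 h4
        refine ⟨θ + θ', Subtype.ext ?_, ?_⟩
        · simp [rotate, smul_smul, ← Complex.exp_add, mul_add]
        · dsimp only
          rw [← mul_assoc, ← Complex.exp_add]
          congr 2
          push_cast
          ring }

/-- The total space of the line bundle `ℒ^k → ℂP^{N-1}`. -/
def Bundle (N k : ℕ) : Type := Quotient (bundleSetoid N k)

/-- The class `[(z, λ)]_k`. -/
def Bundle.mk {N : ℕ} (k : ℕ) (z : Sph N) (a : ℂ) : Bundle N k :=
  Quotient.mk (bundleSetoid N k) (z, a)

/-- The Hermitian norm of a point of `ℒ^k`: `|[(z, λ)]_k| = |λ|`. -/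
def Bundle.size {N k : ℕ} : Bundle N k → ℝ :=
  Quotient.lift (fun p => ‖p.2‖) (by
    rintro ⟨z, a⟩ ⟨z', a'⟩ ⟨θ, -, h2⟩
    dsimp only at h2
    have h : ‖Complex.exp (-Complex.I * k * θ)‖ = 1 := by
      have e : -Complex.I * k * θ = ((-(k * θ) : ℝ) : ℂ) * Complex.I := by push_cast; ring
      rw [e]; exact Complex.norm_exp_ofReal_mul_I _
    change ‖a‖ = ‖a'‖
    rw [h2, norm_mul, h, one_mul])

theorem hopf_rotate {N : ℕ} (θ : ℝ) (z : Sph N) : hopf (rotate θ z) = hopf z :=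
  (Projectivization.mk_eq_mk_iff' ℂ _ _ _ _).2 ⟨Complex.exp (Complex.I * θ), rfl⟩

/-- The bundle projection `ℒ^k → ℂP^{N-1}`. -/
def Bundle.proj {N k : ℕ} : Bundle N k → CP N :=
  Quotient.lift (fun p => hopf p.1) (by
    rintro ⟨z, a⟩ ⟨z', a'⟩ ⟨θ, h1, -⟩
    dsimp only at h1
    subst h1
    exact hopf_rotate θ z')

/-- The radial projection of a nonzero vector to the unit sphere. -/
def toSph {N : ℕ} (v : {v : Cn N // v ≠ 0}) : Sph N :=
  ⟨(‖(v : Cn N)‖ : ℂ)⁻¹ • (v : Cn N), by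
    have h : ‖(v : Cn N)‖ ≠ 0 := norm_ne_zero_iff.2 v.2
    simp [norm_smul, h]⟩

theorem toSph_smul {N : ℕ} {a b : {v : Cn N // v ≠ 0}} {t : ℂ}
    (h : (a : Cn N) = t • (b : Cn N)) : ∃ θ : ℝ, toSph a = rotate θ (toSph b) := by
  have hb : (‖(b : Cn N)‖ : ℂ) ≠ 0 := by exact_mod_cast norm_ne_zero_iff.2 b.2
  have ht : t ≠ 0 := by
    rintro rfl
    exact a.2 (by simpa using h)
  have ht' : (‖t‖ : ℂ) ≠ 0 := by exact_mod_cast norm_ne_zero_iff.2 ht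
  refine ⟨t.arg, Subtype.ext ?_⟩
  simp only [toSph, rotate, h, norm_smul, smul_smul]
  congr 1
  have e := Complex.norm_mul_exp_arg_mul_I t
  rw [mul_comm Complex.I]
  push_cast
  field_simp
  rw [← e]
  simp

/-- The section `s_ψ : π(z) ↦ [(z, ψ(z))]_k` of `ℒ^k` that corresponds to a function `ψ` on the
unit sphere with `ψ(e^{iθ} z) = e^{ikθ} ψ(z)`. -/
def sectionOf {N : ℕ} (k : ℕ) (ψ : Sph N → ℂ)
    (hψ : ∀ (θ : ℝ) (z : Sph N), ψ (rotate θ z) = Complex.exp (Complex.I * k * θ) * ψ z) :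
    CP N → Bundle N k :=
  Projectivization.lift (fun v => Bundle.mk k (toSph v) (ψ (toSph v))) (by
    intro a b t h
    obtain ⟨θ, hθ⟩ := toSph_smul h
    refine Quotient.sound ⟨θ, hθ, ?_⟩
    dsimp only
    rw [hθ, hψ, ← mul_assoc, ← Complex.exp_add]
    simp)

theorem sectionOf_hopf {N : ℕ} (k : ℕ) (ψ : Sph N → ℂ)
    (hψ : ∀ (θ : ℝ) (z : Sph N), ψ (rotate θ z) = Complex.exp (Complex.I * k * θ) * ψ z)
    (z : Sph N) : sectionOf k ψ hψ (hopf z) = Bundle.mk k z (ψ z) := by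
  have hz : ‖(z : Cn N)‖ = 1 := by simp
  have e : ∀ h : (z : Cn N) ≠ 0, toSph ⟨(z : Cn N), h⟩ = z := fun h =>
    Subtype.ext (by simp [toSph, hz])
  simp only [sectionOf, hopf, Projectivization.lift_mk, e]

/-- A reduced function is equivariant under the circle. -/
theorem reduction_rotate {N : ℕ} (k : ℕ) (ψ : Cn N → ℂ) (θ : ℝ) (z : Cn N) :
    reduction k ψ (Complex.exp (Complex.I * θ) • z) =
      Complex.exp (Complex.I * k * θ) * reduction k ψ z := by
  set f : ℝ → ℂ := fun t =>
    Complex.exp (-Complex.I * k * t) * ψ (Complex.exp (Complex.I * t) • z) with hf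
  have hper : Function.Periodic f (2 * Real.pi) := by
    intro t
    have e1 : Complex.exp (-Complex.I * k * ((t + 2 * Real.pi : ℝ) : ℂ)) =
        Complex.exp (-Complex.I * k * t) := by
      rw [Complex.exp_eq_exp_iff_exists_int]
      exact ⟨-k, by push_cast; ring⟩
    have e2 : Complex.exp (Complex.I * ((t + 2 * Real.pi : ℝ) : ℂ)) =
        Complex.exp (Complex.I * t) := by
      rw [Complex.exp_eq_exp_iff_exists_int]
      exact ⟨1, by push_cast; ring⟩
    simp only [hf, e1, e2]
  have key : ∀ t : ℝ, Complex.exp (-Complex.I * k * t) *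
      ψ (Complex.exp (Complex.I * t) • Complex.exp (Complex.I * θ) • z) =
      Complex.exp (Complex.I * k * θ) * f (t + θ) := by
    intro t
    simp only [hf, smul_smul, ← Complex.exp_add, ← mul_assoc]
    congr 2
    · push_cast; ring
    · congr 2; push_cast; ring
  unfold reduction
  simp_rw [key]
  rw [intervalIntegral.integral_const_mul, intervalIntegral.integral_comp_add_right]
  have := hper.intervalIntegral_add_eq θ 0
  rw [zero_add] at this
  rw [zero_add, add_comm (2 * Real.pi) θ, this]
  ring

/-- The reduced state as a section of `ℒ^k → ℂP^{N-1}`. -/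
def reducedSection {N : ℕ} (k : ℕ) (A : Matrix (Fin N) (Fin N) ℂ) (w : Cn N) :
    CP N → Bundle N k :=
  sectionOf k (fun z : Sph N => reducedState k A w z)
    (fun θ z => reduction_rotate k (coherent k A w) θ z)

/-! ### Micro-support, symbol and inner product -/

/-- The micro-support (semi-classical wave-front set) as `k → ∞` of a sequence of states whose
pointwise sizes are `ρ k`. A point is outside it when the sizes are `O(k^{-M})` for every `M`,
uniformly on one neighbourhood of the point. -/
def microSupport {X : Type*} [TopologicalSpace X] (ρ : ℕ → X → ℝ) : Set X :=
  {x | ¬ ∃ U ∈ 𝓝 x, ∀ M : ℕ, ∃ C : ℝ, ∀ᶠ k : ℕ in atTop,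
    ∀ y ∈ U, |ρ k y| ≤ C * ((k : ℝ) ^ M)⁻¹}

/-- The Hermitian orthogonal space `H_w = (ℂ w)^⊥`. -/
abbrev Horiz {N : ℕ} (w : Cn N) : Submodule ℂ (Cn N) := (Submodule.span ℂ {w})ᗮ

/-- The integrand `e^{Q_A(isw+η)/2} e^{-s²/2}`. -/
def symbolIntegrand {N : ℕ} (A : Matrix (Fin N) (Fin N) ℂ) (w η : Cn N) (s : ℝ) : ℂ :=
  Complex.exp (quad A ((Complex.I * s) • w + η) / 2) * Complex.exp (-(s : ℂ) ^ 2 / 2)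

/-- The symbol `σ_A(η) = (2π)⁻¹ e^{-|η|²/2} ∫ e^{Q_A(isw+η)/2} e^{-s²/2} ds`. -/
def symbol {N : ℕ} (A : Matrix (Fin N) (Fin N) ℂ) (w η : Cn N) : ℂ :=
  (1 / (2 * Real.pi) : ℂ) * Complex.exp (-(‖η‖ : ℂ) ^ 2 / 2) * ∫ s : ℝ, symbolIntegrand A w η s

/-- The inner product of `L²(S^{2N-1})`, for the surface measure of the unit sphere. -/
def sphereInner {N : ℕ} (f g : Sph N → ℂ) : ℂ :=
  ∫ z, f z * conj (g z) ∂(lebesgue (Cn N)).toSphere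

end ReducedGaussian

end

open ReducedGaussian

noncomputable section

namespace ReducedGaussian

open scoped ENNReal Pointwise

/-! Positivity of `1 - Aᴴ * A`, Cauchy–Schwarz and compactness of the sphere give `r < 1` with
|Q_A(v)| ≤ r|v|² (`exists_norm_quad_le`). Hence |ψ(z)| ≤ exp(-k(1-r)|z-w|²/2), a Gaussian
concentrated at w. Everything else rests on this decay.

Micro-support: averaging over the circle gives |Ψ(z)| ≤ exp(-k(1-r)d(z)/2), where d = `orbitGap w`
is the squared distance to the orbit of w. So the state is exponentially small off the orbit. On the
orbit, √k|Ψ| tends to |σ(0)| ≠ 0, which is incompatible with O(1/k).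

Rescaled limit: with t = s/√k in the circle average, √k Ψ becomes (2π)⁻¹ times the integral over ℝ
of `wave`, which is dominated by a Gaussian in (s, u) independent of k (`norm_wave_le`). Dominated
convergence gives σ. The closed form is the one-dimensional Gaussian integral in s, which completes
the square of Q(isw + η). The decay of σ then shows that the resulting form lies in `formDisk`.

Inner products: on the sphere, the coordinates (θ, η) ↦ √(1-|η|²)e^{iθ}w + η carry the surface
measure to exactly dθ dL(η), without a density (`map_toSphere_eq_map_hopfChart`). After η = u/√k,
the inner product is 2πk^{-N} times an integral over a ball of radius √k. There √k Ψ = σ + k^{-1/2}τ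
+ O(k^{-1}), with a Gaussian factor in the error (`exists_state_expansion`). Under (u, s) ↦ (-u, -s)
the leading phase is even and its first correction is odd, so σ is even and τ is odd. The k^{-1/2}
term of the product therefore integrates to zero, and the relative error is O(k^{-1}). -/

/-- The complex bilinear form `(u, v) ↦ u A vᵀ`. -/
def bilin {N : ℕ} (A : Matrix (Fin N) (Fin N) ℂ) : Cn N →ₗ[ℂ] Cn N →ₗ[ℂ] ℂ :=
  LinearMap.mk₂ ℂ (fun u v => ∑ i, ∑ j, u i * A i j * v j)
    (fun u u' v => by simp [add_mul, Finset.sum_add_distrib])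
    (fun a u v => by simp [Finset.mul_sum, mul_assoc])
    (fun u v v' => by simp [mul_add, Finset.sum_add_distrib])
    (fun a u v => by
      simp only [Finset.mul_sum, PiLp.smul_apply, smul_eq_mul]
      exact Finset.sum_congr rfl fun i _ => Finset.sum_congr rfl fun j _ => by ring)

/-! ### The quadratic form and its strict norm bound -/

section Quad

variable {N : ℕ} {A : Matrix (Fin N) (Fin N) ℂ}

theorem bilin_apply (u v : Cn N) : bilin A u v = ∑ i, ∑ j, u i * A i j * v j := rfl

theorem quad_eq_bilin (v : Cn N) : quad A v = bilin A v v := rfl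

theorem bilin_comm (hA : A.IsSymm) (u v : Cn N) : bilin A u v = bilin A v u := by
  rw [bilin_apply, bilin_apply, Finset.sum_comm]
  refine Finset.sum_congr rfl fun i _ => Finset.sum_congr rfl fun j _ => ?_
  rw [← hA.apply i j]; ring

theorem quad_add (hA : A.IsSymm) (u v : Cn N) :
    quad A (u + v) = quad A u + 2 * bilin A u v + quad A v := by
  simp only [quad_eq_bilin, map_add, LinearMap.add_apply]
  rw [bilin_comm hA v u]; ring

theorem quad_smul (a : ℂ) (v : Cn N) : quad A (a • v) = a ^ 2 * quad A v := by
  simp only [quad_eq_bilin, map_smul, LinearMap.smul_apply, smul_eq_mul]; ring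

theorem quad_neg (v : Cn N) : quad A (-v) = quad A v := by
  simp [quad_eq_bilin]

@[fun_prop]
theorem continuous_quad : Continuous (quad A) := by
  unfold quad; fun_prop

@[fun_prop]
theorem continuous_bilin : Continuous fun p : Cn N × Cn N => bilin A p.1 p.2 := by
  simp only [bilin_apply]; fun_prop

theorem exists_norm_bilin_le (A : Matrix (Fin N) (Fin N) ℂ) :
    ∃ K : ℝ, 0 ≤ K ∧ ∀ u v : Cn N, ‖bilin A u v‖ ≤ K * ‖u‖ * ‖v‖ := by
  refine ⟨∑ i, ∑ j, ‖A i j‖, by positivity, fun u v => ?_⟩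
  rw [bilin_apply, Finset.sum_mul, Finset.sum_mul]
  refine (norm_sum_le _ _).trans (Finset.sum_le_sum fun i _ => ?_)
  rw [Finset.sum_mul, Finset.sum_mul]
  refine (norm_sum_le _ _).trans (Finset.sum_le_sum fun j _ => ?_)
  rw [norm_mul, norm_mul, mul_comm ‖u i‖]
  gcongr
  · exact PiLp.norm_apply_le u i
  · exact PiLp.norm_apply_le v j

/-- Q_A(v) is the Hermitian product of v̄ with Av, so it is at most |Av| by Cauchy–Schwarz. Testing
`1 - Aᴴ * A` on v gives |v|² - |Av|² > 0. -/
theorem norm_quad_lt_one (hA : A ∈ disk N) {v : Cn N} (hv : ‖v‖ = 1) : ‖quad A v‖ < 1 := by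
  have hv0 : v.ofLp ≠ 0 := by
    intro h
    have : v = 0 := by ext i; simp [h]
    simp [this] at hv
  have hpos := hA.2.dotProduct_mulVec_pos hv0
  set y : Cn N := WithLp.toLp 2 (A *ᵥ v.ofLp) with hy
  have hsq (x : Cn N) : star x.ofLp ⬝ᵥ x.ofLp = (‖x‖ : ℂ) ^ 2 := by
    rw [dotProduct_comm, ← EuclideanSpace.inner_eq_star_dotProduct]
    exact inner_self_eq_norm_sq_to_K x
  have h1 : star v.ofLp ⬝ᵥ ((1 - Aᴴ * A) *ᵥ v.ofLp) = (‖v‖ ^ 2 - ‖y‖ ^ 2 : ℂ) := by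
    rw [Matrix.sub_mulVec, dotProduct_sub, Matrix.one_mulVec, ← Matrix.mulVec_mulVec,
      Matrix.dotProduct_mulVec, Matrix.vecMul_conjTranspose, star_star]
    congr 1
    · exact hsq v
    · exact hsq y
  rw [h1, hv] at hpos
  have h2 : ‖y‖ < 1 := by
    have : (0 : ℝ) < 1 ^ 2 - ‖y‖ ^ 2 := by exact_mod_cast hpos
    nlinarith [norm_nonneg y]
  set x : Cn N := WithLp.toLp 2 (star v.ofLp) with hx
  have hxn : ‖x‖ = 1 := by
    rw [← hv, EuclideanSpace.norm_eq, EuclideanSpace.norm_eq]; simp [hx]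
  have h3 : quad A v = inner ℂ x y := by
    rw [EuclideanSpace.inner_eq_star_dotProduct, dotProduct_comm]
    simp [hx, hy, quad, dotProduct, Matrix.mulVec, Finset.mul_sum, mul_assoc]
  rw [h3]
  exact (norm_inner_le_norm x y).trans_lt (by rwa [hxn, one_mul])

/-- Compactness of the unit sphere makes the strict bound uniform, and homogeneity of degree two
extends it. The gap 1 - r is the source of every Gaussian decay rate below. -/
theorem exists_norm_quad_le (hA : A ∈ disk N) :
    ∃ r : ℝ, 0 ≤ r ∧ r < 1 ∧ ∀ v : Cn N, ‖quad A v‖ ≤ r * ‖v‖ ^ 2 := by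
  obtain ⟨r, hr0, hr1, hr⟩ : ∃ r : ℝ, 0 ≤ r ∧ r < 1 ∧ ∀ v : Cn N, ‖v‖ = 1 → ‖quad A v‖ ≤ r := by
    rcases (Metric.sphere (0 : Cn N) 1).eq_empty_or_nonempty with h | h
    · refine ⟨0, le_rfl, one_pos, fun v hv => ?_⟩
      have : v ∈ Metric.sphere (0 : Cn N) 1 := by simpa using hv
      simp [h] at this
    · obtain ⟨v, hv, hmax⟩ := (isCompact_sphere (0 : Cn N) 1).exists_isMaxOn h
        (f := fun v => ‖quad A v‖) (by fun_prop)
      exact ⟨‖quad A v‖, norm_nonneg _, norm_quad_lt_one hA (by simpa using hv),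
        fun u hu => hmax (by simpa using hu)⟩
  refine ⟨r, hr0, hr1, fun v => ?_⟩
  rcases eq_or_ne v 0 with rfl | hv
  · simp [quad]
  have hn : (‖v‖ : ℂ) ≠ 0 := by exact_mod_cast norm_ne_zero_iff.2 hv
  have hu := hr ((‖v‖ : ℂ)⁻¹ • v) (by simp [norm_smul, hv])
  have : v = (‖v‖ : ℂ) • ((‖v‖ : ℂ)⁻¹ • v) := by rw [smul_smul, mul_inv_cancel₀ hn, one_smul]
  rw [this, quad_smul, norm_mul, mul_comm, norm_smul, mul_pow]
  simp only [norm_pow, Complex.norm_real, norm_norm]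
  have h1 : ‖(‖v‖ : ℂ)⁻¹ • v‖ = 1 := by simp [norm_smul, hv]
  rw [h1, one_pow, mul_one]
  gcongr

end Quad

/-! ### Size of the coherent state and rescaling of the circle average -/

section Coherent

variable {N : ℕ} {A : Matrix (Fin N) (Fin N) ℂ}

theorem coherent_eq (k : ℕ) (w z : Cn N) :
    coherent k A w z = Complex.exp (k * (quad A (z - w) / 2 + inner ℂ w z -
      (‖w‖ : ℂ) ^ 2 / 2 - (‖z‖ : ℂ) ^ 2 / 2)) := by
  unfold coherent
  rw [← Complex.exp_add, ← Complex.exp_add, ← Complex.exp_add]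
  congr 1
  rw [PiLp.inner_apply]
  simp only [RCLike.inner_apply]
  ring

/-- The linear and Gaussian factors of the coherent state combine, in modulus, into a Gaussian
centred at w. -/
theorem re_inner_eq (w z : Cn N) :
    (inner ℂ w z : ℂ).re - ‖w‖ ^ 2 / 2 - ‖z‖ ^ 2 / 2 = -(‖z - w‖ ^ 2 / 2) := by
  have := norm_sub_sq (𝕜 := ℂ) z w
  rw [inner_re_symm] at this
  simp only [RCLike.re_to_complex] at this
  linarith

theorem norm_coherent (k : ℕ) (w z : Cn N) :
    ‖coherent k A w z‖ = Real.exp (k * ((quad A (z - w)).re / 2 - ‖z - w‖ ^ 2 / 2)) := by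
  rw [coherent_eq, Complex.norm_exp]
  congr 1
  have := re_inner_eq w z
  rw [← Complex.ofReal_natCast, Complex.re_ofReal_mul]
  simp only [Complex.add_re, Complex.sub_re, Complex.div_ofNat_re, ← Complex.ofReal_pow,
    Complex.ofReal_re]
  congr 1
  linarith

theorem norm_coherent_le {r : ℝ} (hr : ∀ v : Cn N, ‖quad A v‖ ≤ r * ‖v‖ ^ 2) (k : ℕ) (w z : Cn N) :
    ‖coherent k A w z‖ ≤ Real.exp (-(k * ((1 - r) / 2) * ‖z - w‖ ^ 2)) := by
  rw [norm_coherent]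
  refine Real.exp_le_exp.2 ?_
  have h1 := (Complex.re_le_norm _).trans (hr (z - w))
  have : (quad A (z - w)).re / 2 - ‖z - w‖ ^ 2 / 2 ≤ -((1 - r) / 2 * ‖z - w‖ ^ 2) := by linarith
  calc _ ≤ (k : ℝ) * (-((1 - r) / 2 * ‖z - w‖ ^ 2)) := by gcongr
    _ = _ := by ring

@[fun_prop]
theorem continuous_coherent (k : ℕ) (w : Cn N) : Continuous (coherent k A w) := by
  unfold coherent; fun_prop

theorem continuous_reducedState (k : ℕ) (w : Cn N) : Continuous (reducedState k A w) := by
  unfold reducedState reduction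
  refine continuous_const.mul ?_
  apply intervalIntegral.continuous_parametric_intervalIntegral_of_continuous'
  simp only [Function.uncurry_def]
  fun_prop

theorem reduction_eq_symm (k : ℕ) (ψ : Cn N → ℂ) (z : Cn N) :
    reduction k ψ z = (1 / (2 * Real.pi) : ℂ) * ∫ t in (-Real.pi)..Real.pi,
      Complex.exp (-Complex.I * k * t) * ψ (Complex.exp (Complex.I * t) • z) := by
  have hper : Function.Periodic (fun t : ℝ =>
      Complex.exp (-Complex.I * k * t) * ψ (Complex.exp (Complex.I * t) • z)) (2 * Real.pi) := by
    intro t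
    have e1 : Complex.exp (-Complex.I * k * ((t + 2 * Real.pi : ℝ) : ℂ)) =
        Complex.exp (-Complex.I * k * t) := by
      rw [Complex.exp_eq_exp_iff_exists_int]
      exact ⟨-k, by push_cast; ring⟩
    have e2 : Complex.exp (Complex.I * ((t + 2 * Real.pi : ℝ) : ℂ)) =
        Complex.exp (Complex.I * t) := by
      rw [Complex.exp_eq_exp_iff_exists_int]
      exact ⟨1, by push_cast; ring⟩
    simp only [e1, e2]
  have := hper.intervalIntegral_add_eq 0 (-Real.pi)
  rw [zero_add, show -Real.pi + 2 * Real.pi = Real.pi by ring] at this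
  rw [reduction, this]

/-- The integrand of the reduced state in the rescaled variable `s = √k t`. -/
def wave (k : ℕ) (A : Matrix (Fin N) (Fin N) ℂ) (w z : Cn N) : ℝ → ℂ :=
  (Set.Ioc (-(Real.pi * √k)) (Real.pi * √k)).indicator fun s =>
    Complex.exp (-Complex.I * √(k : ℝ) * s) *
      coherent k A w (Complex.exp (Complex.I * (s / √(k : ℝ) : ℝ)) • z)

theorem sqrt_mul_reducedState {k : ℕ} (hk : k ≠ 0) (w z : Cn N) :
    (√(k : ℝ) : ℂ) * reducedState k A w z = (1 / (2 * Real.pi) : ℂ) * ∫ s, wave k A w z s := by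
  have hk0 : √(k : ℝ) ≠ 0 := by positivity
  unfold wave
  rw [reducedState, reduction_eq_symm, integral_indicator measurableSet_Ioc,
    ← intervalIntegral.integral_of_le (by linarith [show 0 ≤ Real.pi * √(k : ℝ) by positivity]),
    mul_left_comm]
  congr 1
  have := intervalIntegral.integral_comp_div (a := -(Real.pi * √k)) (b := Real.pi * √k) (fun t : ℝ =>
    Complex.exp (-Complex.I * k * t) * coherent k A w (Complex.exp (Complex.I * t) • z)) hk0
  rw [neg_div, mul_div_cancel_right₀ _ hk0, Complex.real_smul] at this
  rw [← this]
  refine intervalIntegral.integral_congr fun s _ => ?_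
  congr 2
  have h2 : ((√(k : ℝ) : ℝ) : ℂ) ^ 2 = k := by
    rw [← Complex.ofReal_pow, Real.sq_sqrt (by positivity)]; simp
  have h3 : ((√(k : ℝ) : ℝ) : ℂ) ≠ 0 := by exact_mod_cast hk0
  push_cast
  rw [← h2]
  field_simp

theorem measurable_wave (k : ℕ) (w : Cn N) :
    Measurable fun p : Cn N × ℝ => wave k A w p.1 p.2 := by
  have : (fun p : Cn N × ℝ => wave k A w p.1 p.2) =
      (Set.univ ×ˢ Set.Ioc (-(Real.pi * √k)) (Real.pi * √k)).indicator (fun p : Cn N × ℝ =>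
      Complex.exp (-Complex.I * √(k : ℝ) * p.2) *
      coherent k A w (Complex.exp (Complex.I * (p.2 / √(k : ℝ) : ℝ)) • p.1)) := by
    ext p
    by_cases h : p.2 ∈ Set.Ioc (-(Real.pi * √k)) (Real.pi * √k) <;> simp [wave, Set.indicator, h]
  rw [this]
  refine Measurable.indicator (Continuous.measurable ?_) (MeasurableSet.univ.prod measurableSet_Ioc)
  fun_prop

end Coherent

/-! ### Taylor estimates -/

section Elementary

/-- The mean value inequality is applied twice along t ↦ exp(th). The factor involves Re h and not
|h|, so that Gaussian decay survives the expansion. -/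
theorem norm_exp_sub_one_sub_le (h : ℂ) :
    ‖Complex.exp h - 1 - h‖ ≤ ‖h‖ ^ 2 * max 1 (Real.exp h.re) := by
  have hM (t : ℝ) (ht : t ∈ Set.Icc (0 : ℝ) 1) :
      ‖Complex.exp (t * h)‖ ≤ max 1 (Real.exp h.re) := by
    rw [Complex.norm_exp, Complex.re_ofReal_mul]
    rcases le_total h.re 0 with h0 | h0
    · exact le_max_of_le_left (Real.exp_le_one_iff.2 (mul_nonpos_of_nonneg_of_nonpos ht.1 h0))
    · exact le_max_of_le_right (Real.exp_le_exp.2 (mul_le_of_le_one_left h0 ht.2))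
  have hd (t : ℝ) : HasDerivAt (fun t : ℝ => Complex.exp (t * h)) (Complex.exp (t * h) * h) t := by
    have := ((Complex.ofRealCLM.hasDerivAt (x := t)).mul_const h).cexp
    simpa using this
  have h1 (t : ℝ) (ht : t ∈ Set.Icc (0 : ℝ) 1) :
      ‖Complex.exp (t * h) - 1‖ ≤ ‖h‖ * max 1 (Real.exp h.re) := by
    have := norm_image_sub_le_of_norm_deriv_le_segment' (f := fun t : ℝ => Complex.exp (t * h))
      (f' := fun t : ℝ => Complex.exp (t * h) * h) (a := 0) (b := 1)
      (C := ‖h‖ * max 1 (Real.exp h.re)) (fun t _ => (hd t).hasDerivWithinAt)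
      (fun t ht => by
        rw [norm_mul, mul_comm]
        gcongr
        exact hM t ⟨ht.1, ht.2.le⟩) t ht
    simp only [Complex.ofReal_zero, zero_mul, Complex.exp_zero, sub_zero] at this
    refine this.trans (mul_le_of_le_one_right (by positivity) ht.2)
  have := norm_image_sub_le_of_norm_deriv_le_segment_01'
    (f := fun t : ℝ => Complex.exp (t * h) - t * h)
    (f' := fun t : ℝ => Complex.exp (t * h) * h - h)
    (C := ‖h‖ * max 1 (Real.exp h.re) * ‖h‖)
    (fun t _ => by
      have h2 := (Complex.ofRealCLM.hasDerivAt (x := t)).mul_const h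
      simp only [Complex.ofRealCLM_apply, Complex.ofReal_one, one_mul] at h2
      exact ((hd t).sub h2).hasDerivWithinAt)
    (fun t ht => by
      rw [show Complex.exp (t * h) * h - h = (Complex.exp (t * h) - 1) * h by ring, norm_mul]
      gcongr
      exact h1 t ⟨ht.1, ht.2.le⟩)
  simp only [Complex.ofReal_zero, Complex.ofReal_one, zero_mul, one_mul, Complex.exp_zero,
    sub_zero] at this
  rw [show Complex.exp h - 1 - h = Complex.exp h - h - 1 by ring]
  refine this.trans (le_of_eq (by ring))

/-- No smallness of b - a is assumed: if both exponentials are bounded by one Gaussian, so is the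
remainder, up to the factor |b - a|². -/
theorem norm_exp_sub_exp_sub_mul_le (a b : ℂ) :
    ‖Complex.exp b - Complex.exp a - Complex.exp a * (b - a)‖ ≤
      ‖b - a‖ ^ 2 * max ‖Complex.exp a‖ ‖Complex.exp b‖ := by
  have h := norm_exp_sub_one_sub_le (b - a)
  have e : Complex.exp b - Complex.exp a - Complex.exp a * (b - a) =
      Complex.exp a * (Complex.exp (b - a) - 1 - (b - a)) := by
    rw [Complex.exp_sub]; field_simp
  rw [e, norm_mul]
  have e2 : max ‖Complex.exp a‖ ‖Complex.exp b‖ =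
      ‖Complex.exp a‖ * max 1 (Real.exp (b - a).re) := by
    rw [mul_max_of_nonneg _ _ (norm_nonneg _), mul_one, ← Complex.norm_exp, ← norm_mul,
      ← Complex.exp_add, add_sub_cancel]
  rw [e2]
  calc _ ≤ ‖Complex.exp a‖ * (‖b - a‖ ^ 2 * max 1 (Real.exp (b - a).re)) := by gcongr
    _ = _ := by ring

/-- With y = √(1-x), the quantity is -(1-y)²/2, and 0 ≤ 1-y ≤ x. -/
theorem abs_sqrt_one_sub_le {x : ℝ} (h0 : 0 ≤ x) (h1 : x ≤ 1) : |√(1 - x) - 1 + x / 2| ≤ x ^ 2 := by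
  have hs := Real.sq_sqrt (show 0 ≤ 1 - x by linarith)
  have hn := Real.sqrt_nonneg (1 - x)
  rw [abs_le]
  constructor <;> nlinarith [sq_nonneg (√(1 - x) - 1), sq_nonneg (√(1 - x) - 1 + x / 2)]

theorem norm_cexp_I_mul_sub_le {θ : ℝ} (h : |θ| ≤ Real.pi) (n : ℕ) :
    ‖Complex.exp (Complex.I * θ) - ∑ m ∈ Finset.range n, (Complex.I * θ) ^ m / m.factorial‖ ≤
      Real.exp Real.pi * |θ| ^ n := by
  have := Complex.norm_exp_sub_sum_le_norm_mul_exp (Complex.I * θ) n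
  simp only [norm_mul, Complex.norm_I, one_mul, Complex.norm_real, Real.norm_eq_abs] at this
  refine this.trans ?_
  rw [mul_comm]
  gcongr

/-- Half of the exponential absorbs the power, because (ax/2)ⁿ/n! ≤ exp(ax/2). -/
theorem exists_pow_mul_exp_le (n : ℕ) {a : ℝ} (ha : 0 < a) :
    ∃ C : ℝ, 0 ≤ C ∧ ∀ x : ℝ, 0 ≤ x → x ^ n * Real.exp (-(a * x)) ≤ C * Real.exp (-(a / 2 * x)) := by
  refine ⟨n.factorial * (2 / a) ^ n, by positivity, fun x hx => ?_⟩
  have h := Real.pow_div_factorial_le_exp (x := a / 2 * x) (by positivity) n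
  rw [div_le_iff₀ (by positivity), mul_pow] at h
  have e : Real.exp (-(a * x)) = Real.exp (-(a / 2 * x)) * Real.exp (-(a / 2 * x)) := by
    rw [← Real.exp_add]; congr 1; ring
  have e2 : Real.exp (a / 2 * x) * Real.exp (-(a / 2 * x)) = 1 := by
    rw [← Real.exp_add]; simp
  have h3 : x ^ n = (2 / a) ^ n * ((a / 2) ^ n * x ^ n) := by
    rw [← mul_assoc, ← mul_pow]
    have : 2 / a * (a / 2) = 1 := by field_simp
    rw [this]; simp
  calc x ^ n * Real.exp (-(a * x))
      ≤ (2 / a) ^ n * (Real.exp (a / 2 * x) * n.factorial) * Real.exp (-(a * x)) := by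
        rw [h3]; gcongr
    _ = n.factorial * (2 / a) ^ n * (Real.exp (a / 2 * x) * Real.exp (-(a / 2 * x))) *
        Real.exp (-(a / 2 * x)) := by rw [e]; ring
    _ = _ := by rw [e2]; ring

/-- Taylor expansion with θ of weight one and x of weight two. All terms of weight at most three are
kept, so the error has weight four. The term xθ³/12, of weight five, is lowered to weight four by
|θ| ≤ π. -/
theorem norm_sqrt_mul_cexp_sub_le {θ x : ℝ} (h : |θ| ≤ Real.pi) (h0 : 0 ≤ x) (h1 : x ≤ 1) :
    ‖(√(1 - x) : ℂ) * Complex.exp (Complex.I * θ) - (1 + Complex.I * θ - (θ ^ 2 + x) / 2 -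
      Complex.I * (θ ^ 3 / 6 + θ * x / 2))‖ ≤ (Real.exp Real.pi + 4) * (θ ^ 2 + x) ^ 2 := by
  have hT := norm_cexp_I_mul_sub_le h 4
  rw [show |θ| ^ 4 = θ ^ 4 by rw [show 4 = 2 * 2 from rfl, pow_mul, sq_abs]; ring] at hT
  have hS := abs_sqrt_one_sub_le h0 h1
  have hpi := Real.pi_le_four
  set e := Complex.exp (Complex.I * θ) with he
  have hen : ‖e‖ = 1 := by rw [he, mul_comm]; exact Complex.norm_exp_ofReal_mul_I θ
  set e3 := ∑ m ∈ Finset.range 4, (Complex.I * θ) ^ m / (m.factorial : ℂ) with he3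
  have he3' : e3 = 1 + Complex.I * θ - θ ^ 2 / 2 - Complex.I * (θ ^ 3 / 6) := by
    have hI := Complex.I_sq
    have hI3 := Complex.I_pow_three
    simp only [he3, Finset.sum_range_succ, Finset.sum_range_zero, Nat.factorial, mul_pow, hI, hI3]
    push_cast; ring
  have key : (√(1 - x) : ℂ) * e - (1 + Complex.I * θ - (θ ^ 2 + x) / 2 -
      Complex.I * (θ ^ 3 / 6 + θ * x / 2)) = ((√(1 - x) - 1 + x / 2 : ℝ) : ℂ) * e +
      ((1 - x / 2 : ℝ) : ℂ) * (e - e3) + ((x * θ ^ 2 / 4 : ℝ) : ℂ) +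
        ((x * θ ^ 3 / 12 : ℝ) : ℂ) * Complex.I := by
    rw [he3']; push_cast; ring
  rw [key]
  have b1 : ‖((√(1 - x) - 1 + x / 2 : ℝ) : ℂ) * e‖ ≤ x ^ 2 := by
    rw [norm_mul, hen, mul_one, Complex.norm_real]; exact hS
  have b2 : ‖((1 - x / 2 : ℝ) : ℂ) * (e - e3)‖ ≤ Real.exp Real.pi * θ ^ 4 := by
    rw [norm_mul, Complex.norm_real, Real.norm_eq_abs, abs_of_nonneg (by linarith)]
    refine (mul_le_of_le_one_left (norm_nonneg _) (by linarith)).trans hT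
  have b3 : ‖((x * θ ^ 2 / 4 : ℝ) : ℂ)‖ ≤ x * θ ^ 2 / 4 := by
    rw [Complex.norm_real, Real.norm_eq_abs, abs_of_nonneg (by positivity)]
  have b4 : ‖((x * θ ^ 3 / 12 : ℝ) : ℂ) * Complex.I‖ ≤ x * θ ^ 2 := by
    rw [norm_mul, Complex.norm_I, mul_one, Complex.norm_real, Real.norm_eq_abs, abs_div, abs_mul,
      abs_of_nonneg h0, abs_pow, pow_succ, sq_abs]
    have : |θ| ≤ 12 := by linarith
    rw [div_le_iff₀ (by norm_num), abs_of_pos (show (0 : ℝ) < 12 by norm_num)]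
    nlinarith [mul_nonneg h0 (sq_nonneg θ)]
  have t1 := norm_add_le (((√(1 - x) - 1 + x / 2 : ℝ) : ℂ) * e +
      ((1 - x / 2 : ℝ) : ℂ) * (e - e3) + ((x * θ ^ 2 / 4 : ℝ) : ℂ))
        (((x * θ ^ 3 / 12 : ℝ) : ℂ) * Complex.I)
  have t2 := norm_add_le (((√(1 - x) - 1 + x / 2 : ℝ) : ℂ) * e +
      ((1 - x / 2 : ℝ) : ℂ) * (e - e3)) (((x * θ ^ 2 / 4 : ℝ) : ℂ))
  have t3 := norm_add_le (((√(1 - x) - 1 + x / 2 : ℝ) : ℂ) * e)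
      (((1 - x / 2 : ℝ) : ℂ) * (e - e3))
  have hE : 0 < Real.exp Real.pi := Real.exp_pos _
  have p1 : 0 ≤ x * θ ^ 2 := by positivity
  have p2 : 0 ≤ θ ^ 4 := by positivity
  have p3 : 0 ≤ x ^ 2 := by positivity
  have p4 : 0 ≤ Real.exp Real.pi * (x * θ ^ 2) := by positivity
  have p5 : 0 ≤ Real.exp Real.pi * x ^ 2 := by positivity
  nlinarith

end Elementary

/-! ### Expansion of the phase in powers of k^{-1/2} -/

section Phase

variable {N : ℕ}

/-- The leading term of the phase at the base point. -/
def phaseZero (A : Matrix (Fin N) (Fin N) ℂ) (w u : Cn N) (s : ℝ) : ℂ :=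
  quad A ((Complex.I * s) • w + u) / 2 - ((s ^ 2 + ‖u‖ ^ 2 : ℝ) : ℂ) / 2

/-- The coefficient of `k^{-1/2}` in the expansion of the phase. -/
def phaseOne (A : Matrix (Fin N) (Fin N) ℂ) (w u : Cn N) (s : ℝ) : ℂ :=
  bilin A ((Complex.I * s) • w + u)
      ((-((s ^ 2 + ‖u‖ ^ 2 : ℝ) : ℂ) / 2) • w + (Complex.I * s) • u) -
    Complex.I * ((s ^ 3 / 6 + s * ‖u‖ ^ 2 / 2 : ℝ) : ℂ)

-- Here ε stands for k^{-1/2}, and R is the size of (s, u). For the rotated sphere point z, the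
-- vector z - w equals ε(aw + eu), and b collects what remains of k times the exponent. The range
-- |εs| ≤ π is the full circle, so the estimate holds on the whole domain of integration and not
-- only near s = 0.
set_option maxHeartbeats 1000000 in
theorem exists_phase_expansion {A : Matrix (Fin N) (Fin N) ℂ} (hA : A.IsSymm) {w : Cn N}
    (hw : ‖w‖ = 1) : ∃ K : ℝ, 0 ≤ K ∧ ∀ (u : Cn N) (s R : ℝ), 0 ≤ R →
      R ^ 2 = s ^ 2 + ‖u‖ ^ 2 → ‖phaseOne A w u s‖ ≤ K * R ^ 3 ∧
      ∀ ε : ℝ, 0 < ε → |ε * s| ≤ Real.pi → ε * ‖u‖ ≤ 1 → ∀ a b e : ℂ,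
        e = Complex.exp (Complex.I * (ε * s : ℝ)) →
        ε * a = (√(1 - (ε * ‖u‖) ^ 2) : ℂ) * e - 1 →
        ε ^ 2 * b = (√(1 - (ε * ‖u‖) ^ 2) : ℂ) * e - 1 - Complex.I * (ε * s) →
        ‖quad A (a • w + e • u) / 2 + b - phaseZero A w u s - ε * phaseOne A w u s‖ ≤
          K * ε ^ 2 * R ^ 4 := by
  obtain ⟨K, hK0, hK⟩ := exists_norm_bilin_le A
  set E := Real.exp Real.pi with hE
  have hE0 : 0 < E := Real.exp_pos _
  set K1 : ℝ := E + 4 with hK1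
  set K2 : ℝ := 1 + 6 * K1 + E with hK2
  set K3 : ℝ := 2 + 6 * K2 with hK3
  refine ⟨4 * K + 1 + (2 * K * K2 + K * K3 ^ 2 + K1), by positivity, fun u s R hR hRR => ?_⟩
  have hsR : |s| ≤ R := abs_le_of_sq_le_sq (by nlinarith [norm_nonneg u]) hR
  have huR : ‖u‖ ≤ R := le_of_sq_le_sq (by nlinarith) hR
  set v0 : Cn N := (Complex.I * s) • w + u with hv0
  set v1 : Cn N := (-((s ^ 2 + ‖u‖ ^ 2 : ℝ) : ℂ) / 2) • w + (Complex.I * s) • u with hv1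
  set β1 : ℂ := -(Complex.I * ((s ^ 3 / 6 + s * ‖u‖ ^ 2 / 2 : ℝ) : ℂ)) with hβ1
  have hnv0 : ‖v0‖ ≤ 2 * R := by
    refine (norm_add_le _ _).trans ?_
    rw [norm_smul, hw]
    simp only [norm_mul, Complex.norm_I, Complex.norm_real, Real.norm_eq_abs]
    linarith
  have hnv1 : ‖v1‖ ≤ 2 * R ^ 2 := by
    refine (norm_add_le _ _).trans ?_
    rw [norm_smul, norm_smul, hw, ← hRR]
    simp only [norm_mul, norm_neg, norm_div, Complex.norm_I, Complex.norm_real, Real.norm_eq_abs]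
    rw [abs_of_nonneg (sq_nonneg R)]
    have : |s| * ‖u‖ ≤ R * R := by gcongr
    norm_num
    nlinarith
  have hnβ1 : ‖β1‖ ≤ R ^ 3 := by
    rw [hβ1, norm_neg, norm_mul, Complex.norm_I, one_mul, Complex.norm_real, Real.norm_eq_abs,
      show s ^ 3 / 6 + s * ‖u‖ ^ 2 / 2 = s * (s ^ 2 / 6 + ‖u‖ ^ 2 / 2) by ring, abs_mul,
      abs_of_nonneg (show 0 ≤ s ^ 2 / 6 + ‖u‖ ^ 2 / 2 by positivity)]
    calc |s| * (s ^ 2 / 6 + ‖u‖ ^ 2 / 2) ≤ R * R ^ 2 := by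
          gcongr
          nlinarith [sq_nonneg s, sq_nonneg ‖u‖]
      _ = R ^ 3 := by ring
  have hR3 : 0 ≤ R ^ 3 := by positivity
  have hT : ‖phaseOne A w u s‖ ≤ (4 * K + 1) * R ^ 3 := by
    have : phaseOne A w u s = bilin A v0 v1 + β1 := by rw [phaseOne, hβ1]; ring
    rw [this]
    refine (norm_add_le _ _).trans ?_
    have : ‖bilin A v0 v1‖ ≤ K * (2 * R) * (2 * R ^ 2) := (hK _ _).trans (by gcongr)
    nlinarith
  refine ⟨hT.trans (by
    have : 0 ≤ 2 * K * K2 + K * K3 ^ 2 + K1 := by positivity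
    nlinarith), ?_⟩
  intro ε hε hθ hx1 a b e he ha hb
  have hεR2 : ε ^ 2 * R ^ 2 = (ε * s) ^ 2 + (ε * ‖u‖) ^ 2 := by rw [hRR]; ring
  have hx0 : 0 ≤ (ε * ‖u‖) ^ 2 := by positivity
  have hx1' : (ε * ‖u‖) ^ 2 ≤ 1 := pow_le_one₀ (by positivity) hx1
  -- (εR)² ≤ 4² + 1 ≤ 6². This lets a surplus factor εR be traded for a constant throughout.
  have hεR : ε * R ≤ 6 := by
    have h1 : (ε * s) ^ 2 ≤ 4 ^ 2 := by
      rw [← sq_abs]; exact pow_le_pow_left₀ (abs_nonneg _) (hθ.trans Real.pi_le_four) 2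
    refine le_of_sq_le_sq ?_ (by norm_num)
    rw [mul_pow, hεR2]; linarith
  have hD := norm_sqrt_mul_cexp_sub_le hθ hx0 hx1'
  rw [← hεR2, ← he] at hD
  have hεc : (ε : ℂ) ≠ 0 := by exact_mod_cast hε.ne'
  set δ : ℂ := b + ((s ^ 2 + ‖u‖ ^ 2 : ℝ) : ℂ) / 2 - ε * β1 with hδ
  have hδn : ‖δ‖ ≤ K1 * ε ^ 2 * R ^ 4 := by
    have h1 : (ε : ℂ) ^ 2 * δ = (√(1 - (ε * ‖u‖) ^ 2) : ℂ) * e - (1 + Complex.I * (ε * s : ℝ) -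
        ((ε * s : ℝ) ^ 2 + ((ε * ‖u‖) ^ 2 : ℝ)) / 2 -
        Complex.I * ((ε * s : ℝ) ^ 3 / 6 + (ε * s : ℝ) * ((ε * ‖u‖) ^ 2 : ℝ) / 2)) := by
      rw [hδ, mul_sub, mul_add, hb, hβ1]; push_cast; ring
    rw [← h1, norm_mul, norm_pow, Complex.norm_real, Real.norm_eq_abs, sq_abs] at hD
    have : ε ^ 2 * ‖δ‖ ≤ ε ^ 2 * (K1 * ε ^ 2 * R ^ 4) := hD.trans (le_of_eq (by ring))
    exact le_of_mul_le_mul_left this (by positivity)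
  -- The coefficient of w is thus determined by b, and its error beyond first order is ε(εβ1 + δ).
  have ha' : a = Complex.I * s + ε * b := by
    apply mul_left_cancel₀ hεc
    linear_combination ha - hb
  have hρ1 : ‖(ε : ℂ) * (ε * β1 + δ)‖ ≤ (1 + 6 * K1) * (ε ^ 2 * R ^ 3) := by
    rw [norm_mul, Complex.norm_real, Real.norm_eq_abs, abs_of_pos hε]
    have h1 : ‖(ε : ℂ) * β1 + δ‖ ≤ ε * R ^ 3 + K1 * ε ^ 2 * R ^ 4 := by
      refine (norm_add_le _ _).trans (add_le_add ?_ hδn)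
      rw [norm_mul, Complex.norm_real, Real.norm_eq_abs, abs_of_pos hε]
      gcongr
    calc ε * ‖(ε : ℂ) * β1 + δ‖ ≤ ε * (ε * R ^ 3 + K1 * ε ^ 2 * R ^ 4) := by gcongr
      _ = (1 + ε * R * K1) * (ε ^ 2 * R ^ 3) := by ring
      _ ≤ _ := by gcongr
  have hρ2 : ‖e - 1 - Complex.I * (ε * s : ℝ)‖ ≤ E * (ε * s) ^ 2 := by
    have := norm_cexp_I_mul_sub_le hθ 2
    rw [← he, sq_abs] at this
    simpa [Finset.sum_range_succ, sub_sub] using this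
  set ρ : Cn N := a • w + e • u - v0 - (ε : ℂ) • v1 with hρ
  have hρn : ‖ρ‖ ≤ K2 * (ε ^ 2 * R ^ 3) := by
    have h1 : ρ = ((ε : ℂ) * (ε * β1 + δ)) • w + (e - 1 - Complex.I * (ε * s : ℝ)) • u := by
      rw [hρ, hv0, hv1, ha', hδ]
      push_cast
      module
    rw [h1]
    refine (norm_add_le _ _).trans ?_
    rw [norm_smul, norm_smul, hw, mul_one, hK2, add_mul _ E]
    refine add_le_add hρ1 ?_
    calc _ ≤ E * (ε * s) ^ 2 * R := by gcongr
      _ = E * ε ^ 2 * |s| ^ 2 * R := by rw [sq_abs]; ring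
      _ ≤ E * ε ^ 2 * R ^ 2 * R := by gcongr
      _ = _ := by ring
  set q : Cn N := (ε : ℂ) • v1 + ρ with hq
  have hqn : ‖q‖ ≤ K3 * (ε * R ^ 2) := by
    refine (norm_add_le _ _).trans ?_
    rw [norm_smul, Complex.norm_real, Real.norm_eq_abs, abs_of_pos hε]
    calc _ ≤ ε * (2 * R ^ 2) + K2 * (ε ^ 2 * R ^ 3) := by gcongr
      _ = (2 + ε * R * K2) * (ε * R ^ 2) := by ring
      _ ≤ _ := by rw [hK3]; gcongr
  have hv : a • w + e • u = v0 + q := by rw [hq, hρ]; abel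
  have e0 : quad A (a • w + e • u) / 2 + b - phaseZero A w u s - ε * phaseOne A w u s =
      bilin A v0 ρ + quad A q / 2 + δ := by
    have h2 : bilin A v0 q = ε * bilin A v0 v1 + bilin A v0 ρ := by simp [hq]
    have h3 : phaseOne A w u s = bilin A v0 v1 + β1 := by rw [phaseOne, hβ1]; ring
    rw [hv, quad_add hA, h2, h3, phaseZero, hδ]
    ring
  rw [e0]
  have n1 : ‖bilin A v0 ρ‖ ≤ 2 * K * K2 * (ε ^ 2 * R ^ 4) := by
    calc _ ≤ K * (2 * R) * (K2 * (ε ^ 2 * R ^ 3)) := (hK _ _).trans (by gcongr)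
      _ = _ := by ring
  have n2 : ‖quad A q / 2‖ ≤ K * K3 ^ 2 * (ε ^ 2 * R ^ 4) := by
    rw [norm_div, RCLike.norm_ofNat]
    refine (half_le_self (norm_nonneg _)).trans ?_
    calc _ ≤ K * (K3 * (ε * R ^ 2)) * (K3 * (ε * R ^ 2)) := (hK _ _).trans (by gcongr)
      _ = _ := by ring
  calc _ ≤ 2 * K * K2 * (ε ^ 2 * R ^ 4) + K * K3 ^ 2 * (ε ^ 2 * R ^ 4) + K1 * ε ^ 2 * R ^ 4 :=
        (norm_add_le _ _).trans (add_le_add ((norm_add_le _ _).trans (add_le_add n1 n2)) hδn)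
    _ ≤ _ := by
      have : 0 ≤ (4 * K + 1) * (ε ^ 2 * R ^ 4) := by positivity
      nlinarith

end Phase

/-! ### Uniform Gaussian domination and expansion of the integrand -/

section Wave

variable {N : ℕ} {A : Matrix (Fin N) (Fin N) ℂ}

theorem norm_cexp_I_mul (t : ℝ) : ‖Complex.exp (Complex.I * t)‖ = 1 := by
  rw [mul_comm]; exact Complex.norm_exp_ofReal_mul_I t

theorem norm_smul_add_smul_sq {w y : Cn N} (hw : ‖w‖ = 1) (hy : inner ℂ w y = 0) (a b : ℂ) :
    ‖a • w + b • y‖ ^ 2 = ‖a‖ ^ 2 + ‖b‖ ^ 2 * ‖y‖ ^ 2 := by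
  have h : inner ℂ (a • w) (b • y) = 0 := by rw [inner_smul_left, inner_smul_right, hy]; simp
  have := norm_add_sq_eq_norm_sq_add_norm_sq_of_inner_eq_zero _ _ h
  rw [sq, this, norm_smul, norm_smul, hw]; ring

/-- The hypothesis c² + |y|² ≥ 1 covers both points that occur: the sphere point, with equality, and
the tangent point w + y, with c = 1. It gives a lower bound 2(1 - c cos t), and cos t ≤ 1 - 2t²/π²
with π² ≤ 10 yields the constant. -/
theorem norm_rotate_sub_sq_ge {w y : Cn N} (hw : ‖w‖ = 1) (hy : inner ℂ w y = 0) {c t : ℝ}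
    (hc0 : 0 ≤ c) (hc1 : c ≤ 1) (hcy : 1 ≤ c ^ 2 + ‖y‖ ^ 2) (ht : |t| ≤ Real.pi) :
    (t ^ 2 + ‖y‖ ^ 2) / 10 ≤ ‖Complex.exp (Complex.I * t) • ((c : ℂ) • w + y) - w‖ ^ 2 := by
  set e := Complex.exp (Complex.I * t) with he
  have hen : ‖e‖ = 1 := norm_cexp_I_mul t
  have h1 : e • ((c : ℂ) • w + y) - w = (c * e - 1) • w + e • y := by module
  have h2 : ‖(c : ℂ) * e - 1‖ ^ 2 = c ^ 2 + 1 - 2 * c * Real.cos t := by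
    have : (c : ℂ) * e - 1 = ((c * Real.cos t - 1 : ℝ) : ℂ) + ((c * Real.sin t : ℝ) : ℂ) * Complex.I := by
      rw [he, mul_comm Complex.I, Complex.exp_mul_I]; push_cast; ring
    rw [this, Complex.sq_norm, Complex.normSq_add_mul_I]
    nlinarith [Real.sin_sq_add_cos_sq t]
  rw [h1, norm_smul_add_smul_sq hw hy, h2, hen]
  have hcos := Real.cos_le_one_sub_mul_cos_sq ht
  have hpi : Real.pi ^ 2 ≤ 10 := by nlinarith [Real.pi_lt_d2, Real.pi_pos]
  have hpi0 : 0 < Real.pi ^ 2 := by positivity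
  have ht2 : t ^ 2 ≤ Real.pi ^ 2 := by rw [← sq_abs]; gcongr
  have h3 : t ^ 2 / 10 ≤ 1 - c * Real.cos t := by
    have h5 : t ^ 2 / 10 ≤ t ^ 2 / Real.pi ^ 2 := by gcongr
    rcases le_total 0 (Real.cos t) with h | h
    · have h4 : c * Real.cos t ≤ Real.cos t := mul_le_of_le_one_left h hc1
      have h6 : 2 / Real.pi ^ 2 * t ^ 2 = 2 * (t ^ 2 / Real.pi ^ 2) := by ring
      have h7 : 0 ≤ t ^ 2 / Real.pi ^ 2 := by positivity
      linarith
    · have h4 : c * Real.cos t ≤ 0 := mul_nonpos_of_nonneg_of_nonpos hc0 h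
      linarith
  have h4 : 0 ≤ 1 - c * Real.cos t := le_trans (by positivity) h3
  nlinarith [sq_nonneg ‖y‖, sq_nonneg (c - 1)]

theorem norm_wave_le {r : ℝ} (hr1 : r < 1) (hr : ∀ v : Cn N, ‖quad A v‖ ≤ r * ‖v‖ ^ 2)
    {w u : Cn N} (hw : ‖w‖ = 1) (hu : inner ℂ w u = 0) {k : ℕ} (hk : k ≠ 0) {c : ℝ}
    (hc0 : 0 ≤ c) (hc1 : c ≤ 1) (hcu : 1 ≤ c ^ 2 + ((√(k : ℝ))⁻¹ * ‖u‖) ^ 2) (s : ℝ) :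
    ‖wave k A w ((c : ℂ) • w + ((√(k : ℝ))⁻¹ : ℂ) • u) s‖ ≤
      Real.exp (-((1 - r) / 20 * (s ^ 2 + ‖u‖ ^ 2))) := by
  have hk0 : 0 < √(k : ℝ) := by positivity
  unfold wave
  by_cases hs : s ∈ Set.Ioc (-(Real.pi * √(k : ℝ))) (Real.pi * √k)
  · rw [Set.indicator_of_mem hs, norm_mul]
    have h1 : ‖Complex.exp (-Complex.I * √(k : ℝ) * s)‖ = 1 := by
      have := norm_cexp_I_mul (-(√(k : ℝ) * s))
      rwa [show Complex.I * ((-(√(k : ℝ) * s) : ℝ) : ℂ) = -Complex.I * √(k : ℝ) * s by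
        push_cast; ring] at this
    rw [h1, one_mul]
    refine (norm_coherent_le hr k w _).trans (Real.exp_le_exp.2 ?_)
    have ht : |s / √(k : ℝ)| ≤ Real.pi := by
      rw [abs_div, abs_of_pos hk0, div_le_iff₀ hk0, abs_le]
      exact ⟨hs.1.le, hs.2⟩
    have hn : ‖((√(k : ℝ))⁻¹ : ℂ) • u‖ = (√(k : ℝ))⁻¹ * ‖u‖ := by
      rw [norm_smul, norm_inv, Complex.norm_real, Real.norm_of_nonneg hk0.le]
    have h2 := norm_rotate_sub_sq_ge hw (y := ((√(k : ℝ))⁻¹ : ℂ) • u)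
      (by rw [inner_smul_right, hu, mul_zero]) hc0 hc1 (by rwa [hn]) ht
    rw [hn, div_pow, mul_pow, inv_pow, Real.sq_sqrt (by positivity)] at h2
    have hk1 : (0 : ℝ) < k := by positivity
    have h3 : (1 - r) / 20 * (s ^ 2 + ‖u‖ ^ 2) =
        k * ((1 - r) / 2) * ((s ^ 2 / k + (k : ℝ)⁻¹ * ‖u‖ ^ 2) / 10) := by
      field_simp; ring
    rw [h3]
    have : 0 ≤ (1 - r) / 2 := by linarith
    gcongr
  · rw [Set.indicator_of_notMem hs, norm_zero]
    positivity

/-- The weaker rate (1-r)/20 is chosen to match `norm_wave_le`, so that one Gaussian dominates both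
exponentials. -/
theorem norm_cexp_phaseZero_le {r : ℝ} (hr1 : r < 1) (hr : ∀ v : Cn N, ‖quad A v‖ ≤ r * ‖v‖ ^ 2)
    {w u : Cn N} (hw : ‖w‖ = 1) (hu : inner ℂ w u = 0) (s : ℝ) :
    ‖Complex.exp (phaseZero A w u s)‖ ≤ Real.exp (-((1 - r) / 20 * (s ^ 2 + ‖u‖ ^ 2))) := by
  rw [Complex.norm_exp]
  refine Real.exp_le_exp.2 ?_
  have h1 := (Complex.re_le_norm _).trans (hr ((Complex.I * s) • w + u))
  have h2 := norm_smul_add_smul_sq hw hu (Complex.I * s) 1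
  rw [one_smul] at h2
  rw [h2] at h1
  simp only [norm_mul, Complex.norm_I, Complex.norm_real, Real.norm_eq_abs, one_mul, sq_abs,
    norm_one, one_pow] at h1
  simp only [phaseZero, Complex.sub_re, Complex.div_ofNat_re, Complex.ofReal_re]
  nlinarith [sq_nonneg s, sq_nonneg ‖u‖]

/-- An exact formula, used with c = √(1 - |u|²/k) on the sphere and with c = 1 on the tangent space.
-/
theorem wave_eq_cexp {w u : Cn N} (hw : ‖w‖ = 1) (hu : inner ℂ w u = 0) {k : ℕ} (hk : k ≠ 0)
    {s : ℝ} (hs : s ∈ Set.Ioc (-(Real.pi * √(k : ℝ))) (Real.pi * √k)) (c : ℝ) {a e : ℂ}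
    (he : e = Complex.exp (Complex.I * (s / √(k : ℝ) : ℝ))) (ha : a = √(k : ℝ) * (c * e - 1)) :
    wave k A w ((c : ℂ) • w + ((√(k : ℝ))⁻¹ : ℂ) • u) s =
      Complex.exp (quad A (a • w + e • u) / 2 +
        k * (c * e - 1 / 2 - c ^ 2 / 2 - Complex.I * (s / √(k : ℝ) : ℝ)) - (‖u‖ : ℂ) ^ 2 / 2) := by
  have hk0 : (√(k : ℝ) : ℂ) ≠ 0 := by
    have : 0 < √(k : ℝ) := by positivity
    exact_mod_cast this.ne'
  have hk2 : (k : ℂ) = (√(k : ℝ) : ℂ) ^ 2 := by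
    rw [← Complex.ofReal_pow, Real.sq_sqrt (by positivity)]; simp
  rw [wave, Set.indicator_of_mem hs, coherent_eq, ← he, ← Complex.exp_add]
  congr 1
  set z := e • ((c : ℂ) • w + ((√(k : ℝ))⁻¹ : ℂ) • u) with hz
  have h1 : z - w = ((√(k : ℝ))⁻¹ : ℂ) • (a • w + e • u) := by
    rw [hz, ha]
    match_scalars
    · field_simp
    · ring
  have h2 : inner ℂ w z = e * c := by
    rw [hz, inner_smul_right, inner_add_right, inner_smul_right, inner_smul_right, hu,
      inner_self_eq_norm_sq_to_K, hw]; simp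
  have h3 : (‖z‖ : ℂ) ^ 2 = c ^ 2 + (√(k : ℝ) : ℂ)⁻¹ ^ 2 * (‖u‖ : ℂ) ^ 2 := by
    have hen : ‖e‖ = 1 := by rw [he]; exact norm_cexp_I_mul _
    have := norm_smul_add_smul_sq hw hu (c : ℂ) ((√(k : ℝ))⁻¹ : ℂ)
    rw [← Complex.ofReal_pow, hz, norm_smul, hen, one_mul, this]
    simp only [Complex.norm_real, norm_inv, Real.norm_eq_abs, abs_of_nonneg (Real.sqrt_nonneg _),
      sq_abs]
    push_cast; ring
  rw [h1, quad_smul, h2, h3, hw, hk2]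
  push_cast
  field_simp
  ring

/-- The point of the unit sphere with horizontal coordinate `u / √k` and nonnegative
coordinate along `w`. -/
def spherePoint (k : ℕ) (w u : Cn N) : Cn N :=
  (√(1 - ((√(k : ℝ))⁻¹ * ‖u‖) ^ 2) : ℂ) • w + ((√(k : ℝ))⁻¹ : ℂ) • u

-- Inside the window |s| ≤ π√k, the phase expansion is exponentiated by
-- `norm_exp_sub_exp_sub_mul_le`, and half of the Gaussian absorbs the powers of R. Outside it the
-- wave vanishes and the approximating terms are themselves small.
set_option maxHeartbeats 1000000 in
theorem exists_wave_expansion (hA : A ∈ disk N) {w : Cn N} (hw : ‖w‖ = 1) :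
    ∃ C b : ℝ, 0 ≤ C ∧ 0 < b ∧ ∀ u : Cn N, inner ℂ w u = 0 → ∀ s : ℝ,
      ‖Complex.exp (phaseZero A w u s)‖ ≤ C * Real.exp (-(b * (s ^ 2 + ‖u‖ ^ 2))) ∧
      ‖Complex.exp (phaseZero A w u s) * phaseOne A w u s‖ ≤
        C * Real.exp (-(b * (s ^ 2 + ‖u‖ ^ 2))) ∧
      ∀ k : ℕ, k ≠ 0 → ‖u‖ ≤ √(k : ℝ) →
        ‖wave k A w (spherePoint k w u) s - Complex.exp (phaseZero A w u s) -
          (√(k : ℝ))⁻¹ * (Complex.exp (phaseZero A w u s) * phaseOne A w u s)‖ ≤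
          C * (k : ℝ)⁻¹ * Real.exp (-(b * (s ^ 2 + ‖u‖ ^ 2))) := by
  obtain ⟨r, hr0, hr1, hr⟩ := exists_norm_quad_le hA
  obtain ⟨K, hK0, hK⟩ := exists_phase_expansion hA.1 hw
  set a : ℝ := (1 - r) / 20 with ha
  have ha0 : 0 < a := by rw [ha]; linarith
  obtain ⟨C0, hC0, h0⟩ := exists_pow_mul_exp_le 0 ha0
  obtain ⟨C1, hC1, h1⟩ := exists_pow_mul_exp_le 1 ha0
  obtain ⟨C2, hC2, h2⟩ := exists_pow_mul_exp_le 2 ha0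
  obtain ⟨C3, hC3, h3⟩ := exists_pow_mul_exp_le 3 ha0
  set C : ℝ := C0 + K * (C1 + C2) + C1 + 50 * K ^ 2 * C3 + K * C2 with hC
  refine ⟨C, a / 2, by positivity, by positivity, fun u hu s => ?_⟩
  set q : ℝ := s ^ 2 + ‖u‖ ^ 2 with hq
  have hq0 : 0 ≤ q := by positivity
  set R : ℝ := √q with hR
  have hR0 : 0 ≤ R := Real.sqrt_nonneg q
  have hR2 : R ^ 2 = q := Real.sq_sqrt hq0
  -- Odd powers of R are traded for integer powers of q = R², to which the absorption estimates
  -- apply.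
  have hR3 : R ^ 3 ≤ q + q ^ 2 := by
    rw [← hR2]; nlinarith [mul_nonneg (sq_nonneg R) (sq_nonneg (R - 1)), sq_nonneg R]
  obtain ⟨hT, hP⟩ := hK u s R hR0 hR2
  set G := Real.exp (-(a * q)) with hG
  set F := Real.exp (-(a / 2 * q)) with hF
  have hG0 : 0 < G := Real.exp_pos _
  have hF0 : 0 < F := Real.exp_pos _
  have hz := norm_cexp_phaseZero_le hr1 hr hw hu s
  rw [← hq, ← ha, ← hG] at hz
  set S := phaseZero A w u s with hS
  set T := phaseOne A w u s with hT'
  have i0 : G ≤ C0 * F := by simpa using h0 q hq0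
  have i1 : q * G ≤ C1 * F := by simpa using h1 q hq0
  have i2 : q ^ 2 * G ≤ C2 * F := h2 q hq0
  have i3 : q ^ 3 * G ≤ C3 * F := h3 q hq0
  have hCF (x : ℝ) (hx : x ≤ C) : x * F ≤ C * F := by gcongr
  refine ⟨(hz.trans i0).trans (hCF _ ?_), ?_, fun k hk huk => ?_⟩
  · have : 0 ≤ K * (C1 + C2) + C1 + 50 * K ^ 2 * C3 + K * C2 := by positivity
    linarith
  · rw [norm_mul]
    calc _ ≤ G * (K * (q + q ^ 2)) := by
          gcongr
          exact hT.trans (by gcongr)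
      _ = K * (q * G + q ^ 2 * G) := by ring
      _ ≤ K * (C1 * F + C2 * F) := by gcongr
      _ = (K * (C1 + C2)) * F := by ring
      _ ≤ C * F := by
          refine hCF _ ?_
          have : 0 ≤ C0 + C1 + 50 * K ^ 2 * C3 + K * C2 := by positivity
          linarith
  have hk0 : 0 < √(k : ℝ) := by positivity
  set ε : ℝ := (√(k : ℝ))⁻¹ with hε
  have hε0 : 0 < ε := inv_pos.2 hk0
  have hεk : (k : ℝ)⁻¹ = ε ^ 2 := by rw [hε, inv_pow, Real.sq_sqrt (by positivity)]
  have hεc : (√(k : ℝ) : ℂ)⁻¹ = (ε : ℂ) := by rw [hε]; push_cast; rfl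
  have hεu : ε * ‖u‖ ≤ 1 := by
    rw [hε, inv_mul_le_iff₀ hk0, mul_one]; exact huk
  rw [hεk]
  by_cases hs : s ∈ Set.Ioc (-(Real.pi * √(k : ℝ))) (Real.pi * √k)
  · have hεs : |ε * s| ≤ Real.pi := by
      rw [abs_mul, abs_of_pos hε0, hε, inv_mul_le_iff₀ hk0, abs_le, mul_comm √(k : ℝ)]
      exact ⟨hs.1.le, hs.2⟩
    set c : ℝ := √(1 - (ε * ‖u‖) ^ 2) with hc
    have hx1 : (ε * ‖u‖) ^ 2 ≤ 1 := pow_le_one₀ (by positivity) hεu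
    have hc2 : c ^ 2 = 1 - (ε * ‖u‖) ^ 2 := Real.sq_sqrt (by linarith)
    have hc1 : c ≤ 1 := Real.sqrt_le_one.2 (by nlinarith [sq_nonneg (ε * ‖u‖)])
    set e := Complex.exp (Complex.I * (s / √(k : ℝ) : ℝ)) with he
    have hse : s / √(k : ℝ) = ε * s := by rw [hε, div_eq_inv_mul]
    have hεc0 : (ε : ℂ) ≠ 0 := by exact_mod_cast hε0.ne'
    have hkε : (√(k : ℝ) : ℂ) = (ε : ℂ)⁻¹ := by rw [← hεc, inv_inv]
    have hkε2 : (k : ℂ) = ((ε : ℂ) ^ 2)⁻¹ := by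
      rw [← Complex.ofReal_pow, ← hεk]; simp
    have hW := wave_eq_cexp (A := A) hw hu hk hs c he rfl
    set α : ℂ := √(k : ℝ) * (c * e - 1) with hα
    set β : ℂ := k * (c * e - 1 - Complex.I * (ε * s : ℝ)) with hβ
    have hPb := hP ε hε0 hεs hεu α β e (by rw [he, hse])
      (by rw [← hc, hα, hkε, mul_inv_cancel_left₀ hεc0])
      (by rw [← hc, hβ, hkε2, mul_inv_cancel_left₀ (pow_ne_zero 2 hεc0)]; push_cast; rfl)
    set P := quad A (α • w + e • u) / 2 + β with hPdef
    have hWP : wave k A w (spherePoint k w u) s = Complex.exp P := by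
      rw [spherePoint, ← hε, ← hc, hW, hPdef, hβ, hse]
      -- Since c² = 1 - ε²|u|², the term -kc²/2 is -k/2 + |u|²/2, which cancels the -|u|²/2.
      congr 1
      have h4 : (c : ℂ) ^ 2 = 1 - (ε * ‖u‖) ^ 2 := by exact_mod_cast hc2
      rw [hkε2, h4]
      field_simp
      ring
    have hWn := norm_wave_le hr1 hr hw hu hk (Real.sqrt_nonneg (1 - (ε * ‖u‖) ^ 2)) hc1
      (by rw [← hc, hc2, ← hε]; linarith) s
    rw [← hc] at hWn
    have hPn : ‖Complex.exp P‖ ≤ G := by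
      rw [← hWP, spherePoint, ← hε, ← hc]
      exact hWn
    rw [hWP]
    have hεR : ε * R ≤ 6 := by
      refine le_of_sq_le_sq ?_ (by norm_num)
      have h4 : (ε * s) ^ 2 ≤ 4 ^ 2 := by
        rw [← sq_abs]; exact pow_le_pow_left₀ (abs_nonneg _) (hεs.trans Real.pi_le_four) 2
      rw [mul_pow, hR2, hq]
      nlinarith
    have hPS : ‖P - S‖ ≤ 7 * K * ε * R ^ 3 := by
      have h5 : ‖P - S‖ ≤ ‖P - S - ε * T‖ + ‖(ε : ℂ) * T‖ := by
        simpa using norm_add_le (P - S - ε * T) (ε * T)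
      rw [norm_mul, Complex.norm_real, Real.norm_of_nonneg hε0.le] at h5
      calc _ ≤ K * ε ^ 2 * R ^ 4 + ε * (K * R ^ 3) := h5.trans (by gcongr)
        _ = (ε * R) * (K * ε * R ^ 3) + K * ε * R ^ 3 := by ring
        _ ≤ 6 * (K * ε * R ^ 3) + K * ε * R ^ 3 := by gcongr
        _ = _ := by ring
    have hsplit : Complex.exp P - Complex.exp S - ε * (Complex.exp S * T) =
        (Complex.exp P - Complex.exp S - Complex.exp S * (P - S)) +
          Complex.exp S * (P - S - ε * T) := by ring
    rw [hsplit]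
    have h6 := norm_exp_sub_exp_sub_mul_le S P
    calc _ ≤ ‖P - S‖ ^ 2 * max ‖Complex.exp S‖ ‖Complex.exp P‖ +
          ‖Complex.exp S‖ * ‖P - S - ε * T‖ := by
          refine (norm_add_le _ _).trans (add_le_add h6 (norm_mul_le _ _))
      _ ≤ (7 * K * ε * R ^ 3) ^ 2 * G + G * (K * ε ^ 2 * R ^ 4) := by
          gcongr
          exact max_le hz hPn
      _ = ε ^ 2 * (49 * K ^ 2 * (q ^ 3 * G) + K * (q ^ 2 * G)) := by rw [← hR2]; ring
      _ ≤ ε ^ 2 * (49 * K ^ 2 * (C3 * F) + K * (C2 * F)) := by gcongr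
      _ = ε ^ 2 * ((49 * K ^ 2 * C3 + K * C2) * F) := by ring
      _ ≤ ε ^ 2 * (C * F) := by
          gcongr
          have : 0 ≤ C0 + K * (C1 + C2) + C1 + K ^ 2 * C3 := by positivity
          linarith
      _ = _ := by ring
  -- Outside the window εR ≥ 1, so factors of εR can be inserted freely until the order ε² is
  -- reached.
  · have hks : √(k : ℝ) ≤ |s| := by
      by_contra hlt
      push Not at hlt
      have h4 : √(k : ℝ) ≤ Real.pi * √k := le_mul_of_one_le_left hk0.le (by linarith [Real.pi_gt_three])
      rw [abs_lt] at hlt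
      exact hs ⟨by linarith, by linarith⟩
    have hεR : 1 ≤ ε * R := by
      rw [hε, ← div_eq_inv_mul, le_div_iff₀ hk0, one_mul]
      exact hks.trans (Real.abs_le_sqrt (by rw [hq]; nlinarith [norm_nonneg u]))
    have hε2q : 1 ≤ ε ^ 2 * q := by
      rw [← hR2, ← mul_pow]; exact one_le_pow₀ hεR
    rw [wave, Set.indicator_of_notMem hs, zero_sub]
    calc _ ≤ ‖Complex.exp S‖ + ε * (‖Complex.exp S‖ * ‖T‖) := by
          refine (norm_sub_le _ _).trans (le_of_eq ?_)
          rw [norm_neg, norm_mul, norm_mul, Complex.norm_real, Real.norm_of_nonneg hε0.le]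
      _ ≤ G + ε * (G * (K * R ^ 3)) := by gcongr
      _ = 1 * G + 1 * ((K * ε * R ^ 3) * G) := by ring
      _ ≤ ε ^ 2 * q * G + (ε * R) * ((K * ε * R ^ 3) * G) := by gcongr
      _ = ε ^ 2 * (q * G + K * (q ^ 2 * G)) := by rw [← hR2]; ring
      _ ≤ ε ^ 2 * (C1 * F + K * (C2 * F)) := by gcongr
      _ = ε ^ 2 * ((C1 + K * C2) * F) := by ring
      _ ≤ ε ^ 2 * (C * F) := by
          gcongr
          have : 0 ≤ C0 + K * (C1 + C2) + 50 * K ^ 2 * C3 := by positivity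
          linarith
      _ = _ := by ring

end Wave

/-! ### The symbol, its first correction, and the rescaled limit -/

section Symbol

variable {N : ℕ} {A : Matrix (Fin N) (Fin N) ℂ}

/-- The coefficient of `k^{-1/2}` in the expansion of the rescaled reduced state. -/
def symbolOne (A : Matrix (Fin N) (Fin N) ℂ) (w u : Cn N) : ℂ :=
  (1 / (2 * Real.pi) : ℂ) * ∫ s : ℝ, Complex.exp (phaseZero A w u s) * phaseOne A w u s

theorem cexp_phaseZero (w u : Cn N) (s : ℝ) : Complex.exp (phaseZero A w u s) =
    Complex.exp (-(‖u‖ : ℂ) ^ 2 / 2) * symbolIntegrand A w u s := by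
  rw [phaseZero, symbolIntegrand, ← Complex.exp_add, ← Complex.exp_add]
  congr 1
  push_cast
  ring

theorem symbol_eq (w u : Cn N) :
    symbol A w u = (1 / (2 * Real.pi) : ℂ) * ∫ s : ℝ, Complex.exp (phaseZero A w u s) := by
  simp_rw [cexp_phaseZero]
  rw [symbol, integral_const_mul, mul_assoc]

theorem phaseZero_neg (w u : Cn N) (s : ℝ) : phaseZero A w (-u) (-s) = phaseZero A w u s := by
  have : (Complex.I * (-s : ℝ)) • w + -u = -((Complex.I * s) • w + u) := by
    push_cast; module
  rw [phaseZero, this, quad_neg, phaseZero, norm_neg, neg_sq]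

theorem phaseOne_neg (w u : Cn N) (s : ℝ) : phaseOne A w (-u) (-s) = -phaseOne A w u s := by
  have h1 : (Complex.I * (-s : ℝ)) • w + -u = -((Complex.I * s) • w + u) := by
    push_cast; module
  have h2 : (Complex.I * (-s : ℝ)) • -u = (Complex.I * s) • u := by
    push_cast; module
  rw [phaseOne, h1, h2, phaseOne, norm_neg, neg_sq, map_neg, LinearMap.neg_apply]
  push_cast
  ring

theorem symbol_neg (w u : Cn N) : symbol A w (-u) = symbol A w u := by
  rw [symbol_eq, symbol_eq, ← integral_neg_eq_self]
  simp_rw [phaseZero_neg]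

/-- `phaseOne` is odd and `phaseZero` even under (u, s) ↦ (-u, -s). This oddness removes the
k^{-1/2} term from inner products. -/
theorem symbolOne_neg (w u : Cn N) : symbolOne A w (-u) = -symbolOne A w u := by
  rw [symbolOne, symbolOne, ← integral_neg_eq_self, ← mul_neg, ← integral_neg]
  simp_rw [phaseZero_neg, phaseOne_neg, mul_neg]

theorem continuous_phaseZero (w : Cn N) :
    Continuous fun p : Cn N × ℝ => phaseZero A w p.1 p.2 := by
  unfold phaseZero; fun_prop

theorem continuous_phaseOne (w : Cn N) :
    Continuous fun p : Cn N × ℝ => phaseOne A w p.1 p.2 := by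
  unfold phaseOne
  refine Continuous.sub ?_ (by fun_prop)
  exact continuous_bilin.comp (f := fun p : Cn N × ℝ =>
    ((Complex.I * p.2) • w + p.1,
      (-((p.2 ^ 2 + ‖p.1‖ ^ 2 : ℝ) : ℂ) / 2) • w + (Complex.I * p.2) • p.1)) (by fun_prop)

theorem stronglyMeasurable_symbol (w : Cn N) : StronglyMeasurable (symbol A w) := by
  have : symbol A w = fun u => (1 / (2 * Real.pi) : ℂ) * ∫ s : ℝ,
      Complex.exp (phaseZero A w u s) := funext fun u => symbol_eq w u
  rw [this]
  refine StronglyMeasurable.const_mul ?_ _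
  exact ((continuous_phaseZero w).cexp.stronglyMeasurable).integral_prod_right'

theorem stronglyMeasurable_symbolOne (w : Cn N) : StronglyMeasurable (symbolOne A w) := by
  refine StronglyMeasurable.const_mul ?_ _
  exact (((continuous_phaseZero w).cexp.mul
    (continuous_phaseOne w)).stronglyMeasurable).integral_prod_right'

theorem exp_neg_mul_add (b s x : ℝ) :
    Real.exp (-(b * (s ^ 2 + x))) = Real.exp (-b * s ^ 2) * Real.exp (-(b * x)) := by
  rw [← Real.exp_add]; congr 1; ring

theorem integrable_exp_neg_mul_add {b : ℝ} (hb : 0 < b) (C x : ℝ) :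
    Integrable fun s : ℝ => C * Real.exp (-(b * (s ^ 2 + x))) := by
  simp_rw [exp_neg_mul_add]
  exact ((integrable_exp_neg_mul_sq hb).mul_const _).const_mul _

theorem norm_integral_le_of_norm_le_gaussian {f : ℝ → ℂ} {b C x : ℝ} (hb : 0 < b)
    (h : ∀ s, ‖f s‖ ≤ C * Real.exp (-(b * (s ^ 2 + x)))) :
    ‖(1 / (2 * Real.pi) : ℂ) * ∫ s, f s‖ ≤ C * √(Real.pi / b) * Real.exp (-(b * x)) := by
  have h1 := norm_integral_le_of_norm_le (integrable_exp_neg_mul_add hb C x)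
    (Filter.Eventually.of_forall h)
  have h2 : ∫ s : ℝ, C * Real.exp (-(b * (s ^ 2 + x))) = C * √(Real.pi / b) * Real.exp (-(b * x)) := by
    simp_rw [exp_neg_mul_add]
    rw [integral_const_mul, integral_mul_const, integral_gaussian]; ring
  rw [norm_mul]
  refine (mul_le_of_le_one_left (norm_nonneg _) ?_).trans (h1.trans_eq h2)
  rw [norm_div, norm_mul, norm_one, Complex.norm_real, Real.norm_of_nonneg Real.pi_pos.le,
    Complex.norm_ofNat, div_le_one (by positivity)]
  linarith [Real.pi_gt_three]

theorem integrable_of_norm_le_gaussian {f : ℝ → ℂ} {b C x : ℝ} (hb : 0 < b)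
    (hf : AEStronglyMeasurable f volume)
    (h : ∀ s, ‖f s‖ ≤ C * Real.exp (-(b * (s ^ 2 + x)))) : Integrable f :=
  (integrable_exp_neg_mul_add hb C x).mono' hf (Filter.Eventually.of_forall h)

theorem exists_state_expansion (hA : A ∈ disk N) {w : Cn N} (hw : ‖w‖ = 1) :
    ∃ C b : ℝ, 0 ≤ C ∧ 0 < b ∧ ∀ u : Cn N, inner ℂ w u = 0 →
      ‖symbol A w u‖ ≤ C * Real.exp (-(b * ‖u‖ ^ 2)) ∧
      ‖symbolOne A w u‖ ≤ C * Real.exp (-(b * ‖u‖ ^ 2)) ∧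
      ∀ k : ℕ, k ≠ 0 → ‖u‖ ≤ √(k : ℝ) →
        ‖√(k : ℝ) * reducedState k A w (spherePoint k w u) - symbol A w u -
          (√(k : ℝ))⁻¹ * symbolOne A w u‖ ≤ C * (k : ℝ)⁻¹ * Real.exp (-(b * ‖u‖ ^ 2)) := by
  obtain ⟨C, b, hC, hb, h⟩ := exists_wave_expansion hA hw
  refine ⟨C * √(Real.pi / b), b, by positivity, hb, fun u hu => ?_⟩
  have m0 : AEStronglyMeasurable (fun s => Complex.exp (phaseZero A w u s)) volume :=
    ((continuous_phaseZero w).cexp.comp (Continuous.prodMk_right u)).aestronglyMeasurable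
  have m1 : AEStronglyMeasurable
      (fun s => Complex.exp (phaseZero A w u s) * phaseOne A w u s) volume :=
    (((continuous_phaseZero w).cexp.mul (continuous_phaseOne w)).comp
      (Continuous.prodMk_right u)).aestronglyMeasurable
  have i0 := integrable_of_norm_le_gaussian hb m0 fun s => (h u hu s).1
  have i1 := integrable_of_norm_le_gaussian hb m1 fun s => (h u hu s).2.1
  refine ⟨?_, ?_, fun k hk huk => ?_⟩
  · rw [symbol_eq]
    exact norm_integral_le_of_norm_le_gaussian hb fun s => (h u hu s).1
  · exact norm_integral_le_of_norm_le_gaussian hb fun s => (h u hu s).2.1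
  · have m2 : AEStronglyMeasurable (wave k A w (spherePoint k w u)) volume :=
      ((measurable_wave k w).comp measurable_prodMk_left).aestronglyMeasurable
    -- The wave is the sum of its remainder and the two approximating terms, all three dominated by
    -- Gaussians.
    have i2 : Integrable (wave k A w (spherePoint k w u)) := by
      have := integrable_of_norm_le_gaussian hb
        ((m2.sub m0).sub (m1.const_mul ((√(k : ℝ))⁻¹ : ℝ))) fun s => (h u hu s).2.2 k hk huk
      refine ((this.add (i1.const_mul ((√(k : ℝ))⁻¹ : ℝ))).add i0).congr
        (Filter.Eventually.of_forall fun s => ?_)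
      simp
    have e : √(k : ℝ) * reducedState k A w (spherePoint k w u) - symbol A w u -
        (√(k : ℝ))⁻¹ * symbolOne A w u = (1 / (2 * Real.pi) : ℂ) * ∫ s,
          (wave k A w (spherePoint k w u) s - Complex.exp (phaseZero A w u s) -
          (√(k : ℝ))⁻¹ * (Complex.exp (phaseZero A w u s) * phaseOne A w u s)) := by
      have i3 : Integrable fun s => wave k A w (spherePoint k w u) s -
          Complex.exp (phaseZero A w u s) := i2.sub i0
      rw [integral_sub i3 (i1.const_mul _), integral_sub i2 i0, integral_const_mul,
        sqrt_mul_reducedState hk, symbol_eq, symbolOne]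
      ring
    rw [e]
    refine (norm_integral_le_of_norm_le_gaussian hb
      fun s => (h u hu s).2.2 k hk huk).trans_eq (by ring)

theorem integrable_symbolIntegrand (hA : A ∈ disk N) {w u : Cn N} (hw : ‖w‖ = 1)
    (hu : inner ℂ w u = 0) : Integrable (symbolIntegrand A w u) := by
  obtain ⟨r, hr0, hr1, hr⟩ := exists_norm_quad_le hA
  have hb : 0 < (1 - r) / 20 := by linarith
  have i0 := integrable_of_norm_le_gaussian (f := fun s => Complex.exp (phaseZero A w u s))
    (C := 1) hb
    ((continuous_phaseZero w).cexp.comp (Continuous.prodMk_right u)).aestronglyMeasurable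
    fun s => by rw [one_mul]; exact norm_cexp_phaseZero_le hr1 hr hw hu s
  simp_rw [cexp_phaseZero] at i0
  refine (i0.const_mul (Complex.exp (-(‖u‖ : ℂ) ^ 2 / 2))⁻¹).congr
    (Filter.Eventually.of_forall fun s => ?_)
  exact inv_mul_cancel_left₀ (Complex.exp_ne_zero _) _

/-- The point w + u/√k lies off the sphere when u ≠ 0, so the sphere expansion does not apply. The
exact phase with c = 1 is used instead. -/
theorem tendsto_wave (w u : Cn N) (hw : ‖w‖ = 1) (hu : inner ℂ w u = 0) (s : ℝ) :
    Tendsto (fun k : ℕ => wave k A w (w + ((√(k : ℝ))⁻¹ : ℂ) • u) s) atTop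
      (𝓝 (Complex.exp (phaseZero A w u s))) := by
  have hsq : Tendsto (fun k : ℕ => √(k : ℝ)) atTop atTop :=
    Real.tendsto_sqrt_atTop.comp tendsto_natCast_atTop_atTop
  have hinv : Tendsto (fun k : ℕ => (√(k : ℝ))⁻¹) atTop (𝓝 0) := tendsto_inv_atTop_zero.comp hsq
  have hlarge : ∀ᶠ k : ℕ in atTop, k ≠ 0 ∧ |s| < Real.pi * √(k : ℝ) := by
    filter_upwards [hsq.eventually_gt_atTop |s|, eventually_ne_atTop 0] with k h1 h2
    refine ⟨h2, h1.trans_le (le_mul_of_one_le_left (Real.sqrt_nonneg _) ?_)⟩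
    linarith [Real.pi_gt_three]
  set e : ℕ → ℂ := fun k => Complex.exp (Complex.I * (s / √(k : ℝ) : ℝ)) with he
  have hθ : Tendsto (fun k : ℕ => s / √(k : ℝ)) atTop (𝓝 0) := by
    simpa [div_eq_mul_inv] using hinv.const_mul s
  have he1 : Tendsto e atTop (𝓝 1) := by
    have : Continuous fun x : ℝ => Complex.exp (Complex.I * x) := by fun_prop
    have h := (this.tendsto 0).comp hθ
    simp only [Complex.ofReal_zero, mul_zero, Complex.exp_zero] at h
    exact h
  have hT (n : ℕ) : ∀ᶠ k : ℕ in atTop, ‖e k - ∑ m ∈ Finset.range n,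
      (Complex.I * (s / √(k : ℝ) : ℝ)) ^ m / m.factorial‖ ≤
      Real.exp Real.pi * |s / √(k : ℝ)| ^ n := by
    filter_upwards [hlarge] with k hk
    refine norm_cexp_I_mul_sub_le ?_ n
    have : 0 < √(k : ℝ) := by have := hk.1; positivity
    rw [abs_div, abs_of_pos this, div_le_iff₀ this]
    exact hk.2.le
  -- The factor √k requires the Taylor polynomial of degree one, and the factor k in `hb` that of
  -- degree two. Both leave an error of order k^{-1/2}.
  have ha : Tendsto (fun k : ℕ => √(k : ℝ) * (1 * e k - 1) - Complex.I * s) atTop (𝓝 0) := by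
    refine squeeze_zero_norm' (a := fun k : ℕ => Real.exp Real.pi * |s| ^ 2 * (√(k : ℝ))⁻¹) ?_
      (by simpa only [mul_zero] using hinv.const_mul (Real.exp Real.pi * |s| ^ 2))
    filter_upwards [hlarge, hT 2] with k hk h
    have hk0 : 0 < √(k : ℝ) := by have := hk.1; positivity
    have hkc : (√(k : ℝ) : ℂ) ≠ 0 := by exact_mod_cast hk0.ne'
    have e1 : √(k : ℝ) * (1 * e k - 1) - Complex.I * s = √(k : ℝ) * (e k -
        ∑ m ∈ Finset.range 2, (Complex.I * (s / √(k : ℝ) : ℝ)) ^ m / m.factorial) := by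
      simp only [Finset.sum_range_succ, Finset.sum_range_zero, Nat.factorial]
      push_cast; field_simp; ring
    rw [e1, norm_mul, Complex.norm_real, Real.norm_of_nonneg hk0.le]
    calc _ ≤ √(k : ℝ) * (Real.exp Real.pi * |s / √(k : ℝ)| ^ 2) := by gcongr
      _ = _ := by rw [abs_div, abs_of_pos hk0]; field_simp
  have hb : Tendsto (fun k : ℕ => (k : ℂ) * (1 * e k - 1 - Complex.I * (s / √(k : ℝ) : ℝ)) +
      (s : ℂ) ^ 2 / 2) atTop (𝓝 0) := by
    refine squeeze_zero_norm' (a := fun k : ℕ => Real.exp Real.pi * |s| ^ 3 * (√(k : ℝ))⁻¹) ?_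
      (by simpa only [mul_zero] using hinv.const_mul (Real.exp Real.pi * |s| ^ 3))
    filter_upwards [hlarge, hT 3] with k hk h
    have hk0 : 0 < √(k : ℝ) := by have := hk.1; positivity
    have hkc : (√(k : ℝ) : ℂ) ≠ 0 := by exact_mod_cast hk0.ne'
    have hk2 : (k : ℂ) = (√(k : ℝ) : ℂ) ^ 2 := by
      rw [← Complex.ofReal_pow, Real.sq_sqrt (by positivity)]; simp
    have e1 : (k : ℂ) * (1 * e k - 1 - Complex.I * (s / √(k : ℝ) : ℝ)) + (s : ℂ) ^ 2 / 2 =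
        (√(k : ℝ) : ℂ) ^ 2 * (e k -
        ∑ m ∈ Finset.range 3, (Complex.I * (s / √(k : ℝ) : ℝ)) ^ m / m.factorial) := by
      rw [hk2]
      simp only [Finset.sum_range_succ, Finset.sum_range_zero, Nat.factorial, mul_pow,
        Complex.I_sq]
      push_cast; field_simp; ring
    rw [e1, norm_mul, norm_pow, Complex.norm_real, Real.norm_of_nonneg hk0.le]
    calc _ ≤ √(k : ℝ) ^ 2 * (Real.exp Real.pi * |s / √(k : ℝ)| ^ 3) := by gcongr
      _ = _ := by rw [abs_div, abs_of_pos hk0]; field_simp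
  have ha' : Tendsto (fun k : ℕ => √(k : ℝ) * (1 * e k - 1)) atTop (𝓝 (Complex.I * s)) := by
    simpa using ha.add_const (Complex.I * s)
  have hb' : Tendsto (fun k : ℕ => (k : ℂ) * (1 * e k - 1 - Complex.I * (s / √(k : ℝ) : ℝ)))
      atTop (𝓝 (-((s : ℂ) ^ 2 / 2))) := by
    have h := hb.sub_const ((s : ℂ) ^ 2 / 2)
    rw [zero_sub] at h
    exact h.congr fun k => by ring
  have hQ : Tendsto (fun k : ℕ => quad A ((√(k : ℝ) * (1 * e k - 1) : ℂ) • w + e k • u)) atTop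
      (𝓝 (quad A ((Complex.I * s) • w + u))) := by
    have := (ha'.smul_const w).add (he1.smul_const u)
    rw [one_smul] at this
    exact (continuous_quad.tendsto _).comp this
  have hlim := (((hQ.div_const 2).add hb').sub_const ((‖u‖ : ℂ) ^ 2 / 2)).cexp
  have e2 : quad A ((Complex.I * s) • w + u) / 2 + -((s : ℂ) ^ 2 / 2) - (‖u‖ : ℂ) ^ 2 / 2 =
      phaseZero A w u s := by rw [phaseZero]; push_cast; ring
  rw [e2] at hlim
  refine hlim.congr' ?_
  filter_upwards [hlarge] with k hk
  have h1 := wave_eq_cexp (A := A) hw hu hk.1 (s := s)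
    ⟨(abs_lt.1 hk.2).1, (abs_lt.1 hk.2).2.le⟩ 1 (e := e k) rfl rfl
  simp only [Complex.ofReal_one, one_smul] at h1
  rw [h1]
  congr 3
  ring

theorem tendsto_sqrt_mul_reducedState (hA : A ∈ disk N) {w u : Cn N} (hw : ‖w‖ = 1)
    (hu : inner ℂ w u = 0) : Tendsto (fun k : ℕ => (√(k : ℝ) : ℂ) *
      reducedState k A w (w + ((√(k : ℝ))⁻¹ : ℂ) • u)) atTop (𝓝 (symbol A w u)) := by
  obtain ⟨r, hr0, hr1, hr⟩ := exists_norm_quad_le hA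
  have hb : 0 < (1 - r) / 20 := by linarith
  have hlim : Tendsto (fun k : ℕ => ∫ s, wave k A w (w + ((√(k : ℝ))⁻¹ : ℂ) • u) s) atTop
      (𝓝 (∫ s, Complex.exp (phaseZero A w u s))) := by
    refine tendsto_integral_filter_of_dominated_convergence
      (fun s => 1 * Real.exp (-((1 - r) / 20 * (s ^ 2 + ‖u‖ ^ 2)))) ?_ ?_
      (integrable_exp_neg_mul_add hb _ _) (Filter.Eventually.of_forall fun s => tendsto_wave w u hw hu s)
    · exact Filter.Eventually.of_forall fun k =>
        ((measurable_wave k w).comp measurable_prodMk_left).aestronglyMeasurable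
    · filter_upwards [eventually_ne_atTop 0] with k hk
      refine Filter.Eventually.of_forall fun s => ?_
      have := norm_wave_le hr1 hr hw hu hk zero_le_one le_rfl
        (by nlinarith [sq_nonneg ((√(k : ℝ))⁻¹ * ‖u‖)]) s
      simpa using this
  rw [symbol_eq]
  refine (hlim.const_mul _).congr' ?_
  filter_upwards [eventually_ne_atTop 0] with k hk
  rw [sqrt_mul_reducedState hk]

end Symbol

/-! ### Lebesgue measure and Gaussians on Hermitian spaces -/

section Lebesgue

variable (H : Type*) [NormedAddCommGroup H] [InnerProductSpace ℂ H] [FiniteDimensional ℂ H]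
  [MeasurableSpace H] [BorelSpace H]

instance : (lebesgue H).IsAddHaarMeasure := by
  let _ : InnerProductSpace ℝ H := InnerProductSpace.rclikeToReal ℂ H
  unfold lebesgue
  infer_instance

theorem integrable_gaussian {b : ℝ} (hb : 0 < b) :
    Integrable (fun v : H => Real.exp (-(b * ‖v‖ ^ 2))) (lebesgue H) := by
  let _ : InnerProductSpace ℝ H := InnerProductSpace.rclikeToReal ℂ H
  have := (GaussianFourier.integrable_cexp_neg_mul_sq_norm_add (V := H) (b := b)
    (by simpa using hb) 0 0).norm
  refine this.congr (Filter.Eventually.of_forall fun v => ?_)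
  simp [Complex.norm_exp, ← Complex.ofReal_pow]

end Lebesgue

/-! ### Closed form of the symbol -/

section ClosedForm

variable {N : ℕ} {A : Matrix (Fin N) (Fin N) ℂ}

theorem re_quad_add_one_pos (hA : A ∈ disk N) {w : Cn N} (hw : ‖w‖ = 1) :
    0 < (quad A w + 1).re := by
  have h1 := norm_quad_lt_one hA hw
  have h2 := (abs_le.1 (Complex.abs_re_le_norm (quad A w))).1
  simp only [Complex.add_re, Complex.one_re]
  linarith

/-- The principal power splits because x is positive and z, lying in the right half-plane, has
argument different from π. -/
theorem ofReal_div_cpow_half {x : ℝ} (hx : 0 < x) {z : ℂ} (hz : 0 < z.re) :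
    ((x : ℂ) / z) ^ (1 / 2 : ℂ) = √x * (1 / z ^ (1 / 2 : ℂ)) := by
  have hz0 : z ≠ 0 := by rintro rfl; simp at hz
  have harg : z.arg ≠ Real.pi := fun h => by
    have := (Complex.arg_eq_pi_iff.1 h).1; linarith
  rw [Real.sqrt_eq_rpow, Complex.ofReal_cpow hx.le, one_div (z ^ _), ← Complex.inv_cpow _ _ harg,
    div_eq_mul_inv, Complex.cpow_def_of_ne_zero (mul_ne_zero (by exact_mod_cast hx.ne')
      (inv_ne_zero hz0)), Complex.cpow_def_of_ne_zero (by exact_mod_cast hx.ne'),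
    Complex.cpow_def_of_ne_zero (inv_ne_zero hz0), Complex.log_ofReal_mul hx (inv_ne_zero hz0),
    ← Complex.exp_add, ← Complex.ofReal_log hx.le]
  congr 1
  push_cast
  ring

/-- Q(isw + u) = -s²Q(w) + 2is B(w,u) + Q(u), so the s-integral is Gaussian with quadratic
coefficient -(Q(w) + 1)/2. Completing the square produces -B(w,u)²/(Q(w) + 1). -/
theorem symbol_closed_form (hA : A ∈ disk N) {w : Cn N} (hw : ‖w‖ = 1) (u : Cn N) :
    symbol A w u = (1 / √(2 * Real.pi) : ℂ) * (1 / (quad A w + 1) ^ (1 / 2 : ℂ)) *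
      Complex.exp ((quad A u - (quad A w + 1)⁻¹ * (bilin A w u * bilin A w u)) / 2) *
        Complex.exp (-(‖u‖ : ℂ) ^ 2 / 2) := by
  have hre := re_quad_add_one_pos hA hw
  set z := quad A w + 1 with hz
  have hz0 : z ≠ 0 := by intro h; simp [h] at hre
  have hint : ∫ s : ℝ, symbolIntegrand A w u s =
      (Real.pi / -(-(z / 2))) ^ (1 / 2 : ℂ) *
        Complex.exp (quad A u / 2 - (Complex.I * bilin A w u) ^ 2 / (4 * (-(z / 2)))) := by
    rw [← integral_cexp_quadratic (b := -(z / 2)) (by simpa using hre)]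
    refine integral_congr_ae (Filter.Eventually.of_forall fun s => ?_)
    simp only [symbolIntegrand]
    rw [← Complex.exp_add, quad_add hA.1, quad_smul, map_smul, LinearMap.smul_apply, smul_eq_mul,
      mul_pow, Complex.I_sq, hz]
    congr 1
    ring
  have e1 : (Real.pi / -(-(z / 2)) : ℂ) = ((2 * Real.pi : ℝ) : ℂ) / z := by
    push_cast; field_simp
  have e2 : quad A u / 2 - (Complex.I * bilin A w u) ^ 2 / (4 * (-(z / 2))) =
      (quad A u - z⁻¹ * (bilin A w u * bilin A w u)) / 2 := by
    rw [mul_pow, Complex.I_sq]; field_simp; ring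
  have hpi : 0 < 2 * Real.pi := by positivity
  rw [symbol, hint, e1, e2, ofReal_div_cpow_half hpi hre]
  have hs : (√(2 * Real.pi) : ℂ) ≠ 0 := by exact_mod_cast (Real.sqrt_pos.2 hpi).ne'
  have hs2 : (2 * Real.pi : ℂ) = (√(2 * Real.pi) : ℂ) * √(2 * Real.pi) := by
    rw [← Complex.ofReal_mul, Real.mul_self_sqrt hpi.le]; push_cast; rfl
  rw [hs2]
  field_simp

theorem symbol_zero_ne_zero (hA : A ∈ disk N) {w : Cn N} (hw : ‖w‖ = 1) : symbol A w 0 ≠ 0 := by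
  have hre := re_quad_add_one_pos hA hw
  have hz0 : quad A w + 1 ≠ 0 := by intro h; simp [h] at hre
  have hs : (√(2 * Real.pi) : ℂ) ≠ 0 := by
    exact_mod_cast (Real.sqrt_pos.2 (by positivity : (0 : ℝ) < 2 * Real.pi)).ne'
  rw [symbol_closed_form hA hw]
  refine mul_ne_zero (mul_ne_zero (mul_ne_zero (one_div_ne_zero hs) (one_div_ne_zero ?_))
    (Complex.exp_ne_zero _)) (Complex.exp_ne_zero _)
  rw [Complex.cpow_def_of_ne_zero hz0]
  exact Complex.exp_ne_zero _

/-- The quadratic form on `(ℂ w)^⊥` in the exponent of the symbol. -/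
def reducedForm (A : Matrix (Fin N) (Fin N) ℂ) (w : Cn N) : QuadraticForm ℂ (Horiz w) :=
  (LinearMap.BilinMap.toQuadraticMap (bilin A)).comp (Horiz w).subtype -
    (quad A w + 1)⁻¹ • QuadraticMap.linMulLin ((bilin A w).comp (Horiz w).subtype)
      ((bilin A w).comp (Horiz w).subtype)

theorem reducedForm_apply (w : Cn N) (η : Horiz w) : reducedForm A w η =
    quad A η - (quad A w + 1)⁻¹ * (bilin A w η * bilin A w η) := rfl

theorem inner_horiz {w : Cn N} (η : Horiz w) : inner ℂ w (η : Cn N) = 0 :=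
  Submodule.mem_orthogonal_singleton_iff_inner_right.1 η.2

theorem symbol_eq_reducedForm (hA : A ∈ disk N) {w : Cn N} (hw : ‖w‖ = 1) (η : Horiz w) :
    symbol A w η = (1 / √(2 * Real.pi) : ℂ) * (1 / (quad A w + 1) ^ (1 / 2 : ℂ)) *
      Complex.exp (reducedForm A w η / 2) * Complex.exp (-(‖η‖ : ℂ) ^ 2 / 2) := by
  rw [symbol_closed_form hA hw, reducedForm_apply]; rfl

theorem continuous_reducedForm (w : Cn N) : Continuous (reducedForm A w) := by
  have : (reducedForm A w : Horiz w → ℂ) = fun η : Horiz w => quad A η -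
      (quad A w + 1)⁻¹ * (bilin A w η * bilin A w η) := funext fun η => reducedForm_apply w η
  rw [this]
  have h : Continuous fun η : Horiz w => bilin A w η :=
    continuous_bilin.comp (f := fun η : Horiz w => (w, (η : Cn N))) (by fun_prop)
  fun_prop

/-- Up to a nonzero constant the function to be tested is the symbol, whose Gaussian decay is
already known. No direct estimate of the reduced form is needed. -/
theorem reducedForm_mem_formDisk (hA : A ∈ disk N) {w : Cn N} (hw : ‖w‖ = 1) :
    reducedForm A w ∈ formDisk (Horiz w) := by
  obtain ⟨C, b, hC, hb, h⟩ := exists_state_expansion hA hw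
  set c : ℂ := (1 / √(2 * Real.pi) : ℂ) * (1 / (quad A w + 1) ^ (1 / 2 : ℂ)) with hc
  have hc0 : c ≠ 0 := by
    have := symbol_zero_ne_zero hA hw
    rw [symbol_closed_form hA hw, mul_assoc] at this
    exact left_ne_zero_of_mul this
  have hcont := continuous_reducedForm (A := A) w
  have hmeas : AEStronglyMeasurable (fun v : Horiz w => Complex.exp (reducedForm A w v / 2) *
      Complex.exp (-(‖v‖ : ℂ) ^ 2 / 2)) (lebesgue (Horiz w)) :=
    Continuous.aestronglyMeasurable (by fun_prop)
  refine (memLp_two_iff_integrable_sq_norm hmeas).2 ?_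
  refine ((integrable_gaussian (Horiz w) (b := 2 * b) (by positivity)).const_mul
    ((‖c‖⁻¹ * C) ^ 2)).mono' (hmeas.norm.pow 2) (Filter.Eventually.of_forall fun v => ?_)
  have h1 := (h v (inner_horiz v)).1
  rw [symbol_eq_reducedForm hA hw, ← hc, mul_assoc, norm_mul, Submodule.coe_norm] at h1
  rw [Real.norm_of_nonneg (by positivity)]
  have h2 : Real.exp (-(2 * b * ‖v‖ ^ 2)) = Real.exp (-(b * ‖v‖ ^ 2)) ^ 2 := by
    rw [← Real.exp_nat_mul]; congr 1; push_cast; ring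
  rw [h2, ← mul_pow]
  refine pow_le_pow_left₀ (norm_nonneg _) ?_ 2
  rw [mul_assoc, le_inv_mul_iff₀ (norm_pos_iff.2 hc0)]
  exact h1

end ClosedForm

/-! ### Micro-support of the reduced state -/

section MicroSupport

variable {N : ℕ} {A : Matrix (Fin N) (Fin N) ℂ}

/-- By continuity g stays above half its value at x on a neighbourhood, which makes the exponential
decay uniform there. -/
theorem notMem_microSupport_of_exp_decay {X : Type*} [TopologicalSpace X] {ρ : ℕ → X → ℝ}
    {g : X → ℝ} (hg : Continuous g) {a : ℝ} (ha : 0 < a)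
    (h : ∀ k x, |ρ k x| ≤ Real.exp (-(k * a * g x))) {x : X} (hx : 0 < g x) :
    x ∉ microSupport ρ := by
  rw [microSupport, Set.mem_ofPred_eq, not_not]
  refine ⟨{y | g x / 2 < g y}, (isOpen_lt continuous_const hg).mem_nhds (half_lt_self hx),
    fun M => ?_⟩
  obtain ⟨C, hC, hCM⟩ := exists_pow_mul_exp_le M (a := a * (g x / 2)) (by positivity)
  refine ⟨C, ?_⟩
  filter_upwards [eventually_ne_atTop 0] with k hk y hy
  have hk0 : (0 : ℝ) < k := by positivity
  rw [← div_eq_mul_inv, le_div_iff₀ (by positivity), mul_comm]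
  calc (k : ℝ) ^ M * |ρ k y| ≤ (k : ℝ) ^ M * Real.exp (-(a * (g x / 2) * k)) := by
        gcongr
        refine (h k y).trans (Real.exp_le_exp.2 (neg_le_neg ?_))
        have : g x / 2 ≤ g y := le_of_lt hy
        calc _ = k * a * (g x / 2) := by ring
          _ ≤ _ := by gcongr
    _ ≤ C * Real.exp (-(a * (g x / 2) / 2 * k)) := hCM k hk0.le
    _ ≤ C := mul_le_of_le_one_right hC (Real.exp_le_one_iff.2 (by
        rw [neg_nonpos]; positivity))

theorem mem_microSupport_of_tendsto {X : Type*} [TopologicalSpace X] {ρ : ℕ → X → ℝ} {x : X}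
    {l : ℝ} (hl : l ≠ 0) (h : Tendsto (fun k : ℕ => √(k : ℝ) * ρ k x) atTop (𝓝 l)) :
    x ∈ microSupport ρ := by
  rintro ⟨U, hU, hM⟩
  -- The exponent M = 1 already contradicts a nonzero limit, because √k · k⁻¹ tends to zero.
  obtain ⟨C, hC⟩ := hM 1
  refine hl (tendsto_nhds_unique h ?_)
  have hinv : Tendsto (fun k : ℕ => C * (√(k : ℝ))⁻¹) atTop (𝓝 0) := by
    simpa using (tendsto_inv_atTop_zero.comp
      (Real.tendsto_sqrt_atTop.comp tendsto_natCast_atTop_atTop)).const_mul C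
  refine squeeze_zero_norm' ?_ hinv
  filter_upwards [hC, eventually_ne_atTop 0] with k hk hk0
  have hs : 0 < √(k : ℝ) := by positivity
  have := hk x (mem_of_mem_nhds hU)
  rw [norm_mul, Real.norm_of_nonneg hs.le, Real.norm_eq_abs]
  calc _ ≤ √(k : ℝ) * (C * ((k : ℝ) ^ 1)⁻¹) := by gcongr
    _ = C * (√(k : ℝ))⁻¹ := by
      rw [pow_one]
      nth_rewrite 2 [← Real.mul_self_sqrt (show (0 : ℝ) ≤ k by positivity)]
      field_simp

/-- The squared distance from `z` to the circle orbit of a unit vector `w`. -/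
def orbitGap (w z : Cn N) : ℝ := ‖z‖ ^ 2 + 1 - 2 * ‖(inner ℂ w z : ℂ)‖

@[fun_prop]
theorem continuous_orbitGap (w : Cn N) : Continuous (orbitGap w) := by
  unfold orbitGap; fun_prop

theorem norm_rotate_sub_sq {w : Cn N} (hw : ‖w‖ = 1) (z : Cn N) (t : ℝ) :
    ‖Complex.exp (Complex.I * t) • z - w‖ ^ 2 =
      ‖z‖ ^ 2 + 1 - 2 * (Complex.exp (Complex.I * t) * inner ℂ w z).re := by
  have h := re_inner_eq w (Complex.exp (Complex.I * t) • z)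
  rw [inner_smul_right, norm_smul, norm_cexp_I_mul, hw] at h
  linarith

theorem norm_reducedState_le {r : ℝ} (hr1 : r < 1) (hr : ∀ v : Cn N, ‖quad A v‖ ≤ r * ‖v‖ ^ 2)
    {w : Cn N} (hw : ‖w‖ = 1) (k : ℕ) (z : Cn N) :
    ‖reducedState k A w z‖ ≤ Real.exp (-(k * ((1 - r) / 2) * orbitGap w z)) := by
  unfold reducedState reduction
  have h := intervalIntegral.norm_integral_le_of_norm_le_const
    (C := Real.exp (-(k * ((1 - r) / 2) * orbitGap w z))) (a := 0) (b := 2 * Real.pi)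
    (f := fun t : ℝ => Complex.exp (-Complex.I * k * t) *
      coherent k A w (Complex.exp (Complex.I * t) • z)) fun t _ => by
    have h1 : ‖Complex.exp (-Complex.I * k * t)‖ = 1 := by
      have := norm_cexp_I_mul (-(k * t))
      rwa [show Complex.I * ((-(k * t) : ℝ) : ℂ) = -Complex.I * k * t by push_cast; ring] at this
    rw [norm_mul, h1, one_mul]
    refine (norm_coherent_le hr k w _).trans (Real.exp_le_exp.2 (neg_le_neg ?_))
    have h2 : orbitGap w z ≤ ‖Complex.exp (Complex.I * t) • z - w‖ ^ 2 := by
      rw [norm_rotate_sub_sq hw, orbitGap]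
      have := Complex.re_le_norm (Complex.exp (Complex.I * t) * inner ℂ w z)
      rw [norm_mul, norm_cexp_I_mul, one_mul] at this
      linarith
    have : 0 ≤ (1 - r) / 2 := by linarith
    gcongr
  have hpi : 0 < 2 * Real.pi := by positivity
  rw [sub_zero, abs_of_pos hpi] at h
  rw [norm_mul, norm_div, norm_one, norm_mul, Complex.norm_real, Complex.norm_ofNat,
    Real.norm_of_nonneg Real.pi_pos.le, one_div, inv_mul_le_iff₀ hpi, mul_comm (2 * Real.pi)]
  exact h

/-- Rotating z by minus the argument of its product with w makes that product equal to its modulus,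
and the squared distance to w becomes exactly `orbitGap w z`. -/
theorem exists_eq_rotate_of_orbitGap_nonpos {w : Cn N} (hw : ‖w‖ = 1) {z : Cn N}
    (hz : orbitGap w z ≤ 0) :
    ∃ t ∈ Set.Icc (0 : ℝ) (2 * Real.pi), z = Complex.exp (Complex.I * t) • w := by
  set c : ℂ := inner ℂ w z with hc
  have h1 : Complex.exp (Complex.I * ((-c.arg : ℝ) : ℂ)) * c = ‖c‖ := by
    nth_rewrite 2 [← Complex.norm_mul_exp_arg_mul_I c]
    rw [mul_left_comm, ← Complex.exp_add]
    push_cast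
    rw [show Complex.I * -(c.arg : ℂ) + c.arg * Complex.I = 0 by ring, Complex.exp_zero, mul_one]
  have h2 := norm_rotate_sub_sq hw z (-c.arg)
  rw [← hc, h1, Complex.ofReal_re] at h2
  have h3 : ‖Complex.exp (Complex.I * ((-c.arg : ℝ) : ℂ)) • z - w‖ ^ 2 ≤ 0 := by
    rw [h2]; exact hz
  have h4 : Complex.exp (Complex.I * ((-c.arg : ℝ) : ℂ)) • z = w := by
    rw [← sub_eq_zero, ← norm_eq_zero]
    exact pow_eq_zero_iff (two_ne_zero) |>.1 (le_antisymm h3 (sq_nonneg _))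
  have h5 : z = Complex.exp (Complex.I * c.arg) • w := by
    rw [← h4, smul_smul, ← Complex.exp_add]
    push_cast
    rw [show Complex.I * (c.arg : ℂ) + Complex.I * -c.arg = 0 by ring, Complex.exp_zero, one_smul]
  have hpi := Real.pi_pos
  -- The argument lies in (-π, π]; negative values are shifted by 2π.
  rcases le_or_gt 0 c.arg with h | h
  · exact ⟨c.arg, ⟨h, (Complex.arg_le_pi c).trans (by linarith)⟩, h5⟩
  · refine ⟨c.arg + 2 * Real.pi, ⟨by linarith [Complex.neg_pi_lt_arg c], by linarith⟩, ?_⟩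
    rw [h5]
    congr 1
    rw [Complex.exp_eq_exp_iff_exists_int]
    exact ⟨-1, by push_cast; ring⟩

theorem tendsto_norm_reducedState_orbit (hA : A ∈ disk N) {w : Cn N} (hw : ‖w‖ = 1) (t : ℝ) :
    Tendsto (fun k : ℕ => √(k : ℝ) * ‖reducedState k A w (Complex.exp (Complex.I * t) • w)‖) atTop
      (𝓝 ‖symbol A w 0‖) := by
  have h := (tendsto_sqrt_mul_reducedState hA hw (inner_zero_right (𝕜 := ℂ) w)).norm
  refine h.congr fun k => ?_
  rw [smul_zero, add_zero, norm_mul, Complex.norm_real, Real.norm_of_nonneg (Real.sqrt_nonneg _)]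
  have h1 : ‖Complex.exp (Complex.I * k * t)‖ = 1 := by
    have := norm_cexp_I_mul (k * t)
    rwa [show Complex.I * ((k * t : ℝ) : ℂ) = Complex.I * k * t by push_cast; ring] at this
  rw [reducedState, reduction_rotate, norm_mul, h1, one_mul]

theorem norm_symbol_zero_ne_zero (hA : A ∈ disk N) {w : Cn N} (hw : ‖w‖ = 1) :
    ‖symbol A w 0‖ ≠ 0 :=
  norm_ne_zero_iff.2 (symbol_zero_ne_zero hA hw)

theorem microSupport_reducedState (hA : A ∈ disk N) {w : Cn N} (hw : ‖w‖ = 1) :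
    microSupport (fun k (z : Cn N) => ‖reducedState k A w z‖) =
      {z | ∃ t ∈ Set.Icc (0 : ℝ) (2 * Real.pi), z = Complex.exp (Complex.I * t) • w} := by
  obtain ⟨r, hr0, hr1, hr⟩ := exists_norm_quad_le hA
  ext z
  refine ⟨fun hz => ?_, ?_⟩
  · refine exists_eq_rotate_of_orbitGap_nonpos hw (not_lt.1 fun hpos => ?_)
    refine notMem_microSupport_of_exp_decay (continuous_orbitGap w) (a := (1 - r) / 2)
      (by linarith) (fun k x => ?_) hpos hz
    rw [abs_norm]
    exact norm_reducedState_le hr1 hr hw k x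
  · rintro ⟨t, -, rfl⟩
    exact mem_microSupport_of_tendsto (norm_symbol_zero_ne_zero hA hw)
      (tendsto_norm_reducedState_orbit hA hw t)

theorem microSupport_reducedState_sphere (hA : A ∈ disk N) (w : Sph N) :
    microSupport (fun k (z : Sph N) => ‖reducedState k A w z‖) =
      {z | ∃ t ∈ Set.Icc (0 : ℝ) (2 * Real.pi), z = rotate t w} := by
  have hw : ‖(w : Cn N)‖ = 1 := by simp
  obtain ⟨r, hr0, hr1, hr⟩ := exists_norm_quad_le hA
  ext z
  refine ⟨fun hz => ?_, ?_⟩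
  · obtain ⟨t, ht, h⟩ := exists_eq_rotate_of_orbitGap_nonpos hw (z := z) (not_lt.1 fun hpos => by
      refine notMem_microSupport_of_exp_decay (g := fun z : Sph N => orbitGap (w : Cn N) z)
        (by fun_prop) (a := (1 - r) / 2) (by linarith) (fun k x => ?_) hpos hz
      rw [abs_norm]
      exact norm_reducedState_le hr1 hr hw k x)
    exact ⟨t, ht, Subtype.ext h⟩
  · rintro ⟨t, -, rfl⟩
    exact mem_microSupport_of_tendsto (norm_symbol_zero_ne_zero hA hw)
      (tendsto_norm_reducedState_orbit hA hw t)

theorem hopf_surjective : Function.Surjective (hopf (N := N)) := by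
  intro p
  induction p using Projectivization.ind with
  | h v hv =>
    have : (‖v‖ : ℂ)⁻¹ ≠ 0 := inv_ne_zero (by exact_mod_cast norm_ne_zero_iff.2 hv)
    exact ⟨toSph ⟨v, hv⟩, (Projectivization.mk_eq_mk_iff' ℂ _ _ _ _).2 ⟨(‖v‖ : ℂ)⁻¹, rfl⟩⟩

/-- The function on `ℂP^{N-1}` induced by `orbitGap`. -/
def orbitGapCP (w : Cn N) : CP N → ℝ :=
  Projectivization.lift (fun v => 2 - 2 * (‖(inner ℂ w (v : Cn N) : ℂ)‖ / ‖(v : Cn N)‖)) (by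
    rintro ⟨a, ha⟩ ⟨b, hb⟩ t (h : a = t • b)
    subst h
    have ht : ‖t‖ ≠ 0 := fun h0 => ha (by rw [norm_eq_zero.1 h0, zero_smul])
    simp only [inner_smul_right, norm_smul, norm_mul]
    rw [mul_div_mul_left _ _ ht])

theorem orbitGapCP_hopf (w : Cn N) (z : Sph N) : orbitGapCP w (hopf z) = orbitGap w z := by
  have hz : ‖(z : Cn N)‖ = 1 := by simp
  simp only [orbitGapCP, hopf, Projectivization.lift_mk, hz, orbitGap]
  ring

/-- Projective space carries the topology coinduced by `hopf`, so continuity is tested on the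
sphere. -/
theorem continuous_orbitGapCP (w : Cn N) : Continuous (orbitGapCP w) := by
  refine continuous_coinduced_dom.2 ?_
  have : orbitGapCP w ∘ hopf = fun z : Sph N => orbitGap w z :=
    funext fun z => orbitGapCP_hopf w z
  rw [this]
  fun_prop

theorem size_reducedSection_hopf (k : ℕ) (w : Cn N) (z : Sph N) :
    (reducedSection k A w (hopf z)).size = ‖reducedState k A w z‖ :=
  congrArg Bundle.size (sectionOf_hopf k (fun z : Sph N => reducedState k A w z)
    (fun θ z => reduction_rotate k (coherent k A w) θ z) z)

theorem microSupport_reducedSection (hA : A ∈ disk N) (w : Sph N) :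
    microSupport (fun k (p : CP N) => (reducedSection k A w p).size) = {hopf w} := by
  have hw : ‖(w : Cn N)‖ = 1 := by simp
  obtain ⟨r, hr0, hr1, hr⟩ := exists_norm_quad_le hA
  ext p
  obtain ⟨z, rfl⟩ := hopf_surjective p
  refine ⟨fun hz => ?_, fun h => ?_⟩
  · obtain ⟨t, ht, h⟩ := exists_eq_rotate_of_orbitGap_nonpos hw (z := z) (not_lt.1 fun hpos => by
      rw [← orbitGapCP_hopf] at hpos
      refine notMem_microSupport_of_exp_decay (continuous_orbitGapCP (w : Cn N))
        (a := (1 - r) / 2) (by linarith) (fun k x => ?_) hpos hz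
      obtain ⟨x, rfl⟩ := hopf_surjective x
      rw [size_reducedSection_hopf, abs_norm, orbitGapCP_hopf]
      exact norm_reducedState_le hr1 hr hw k x)
    have : z = rotate t w := Subtype.ext h
    rw [this, hopf_rotate]
    rfl
  · rw [Set.mem_singleton_iff.1 h]
    refine mem_microSupport_of_tendsto (norm_symbol_zero_ne_zero hA hw) ?_
    simp_rw [size_reducedSection_hopf]
    simpa using tendsto_norm_reducedState_orbit hA hw 0

end MicroSupport

/-! ### Integration over ℂ^N in adapted coordinates -/

section Split

variable {N : ℕ}

/-- The isometry `ℂ ⊕ (ℂ w)^⊥ → ℂ^N`, `(a, ζ) ↦ a w + ζ`. -/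
def splitIsometry {w : Cn N} (hw : ‖w‖ = 1) : WithLp 2 (ℂ × Horiz w) ≃ₗᵢ[ℝ] Cn N :=
  LinearIsometryEquiv.ofSurjective
    { toFun := fun p => p.fst • w + (p.snd : Cn N)
      map_add' := fun p q => by simp; module
      map_smul' := fun a p => by simp [mul_smul]
      norm_map' := fun p => by
        have h := norm_smul_add_smul_sq hw (inner_horiz p.snd) p.fst 1
        rw [one_smul, norm_one, one_pow, one_mul] at h
        have h2 := WithLp.prod_norm_sq_eq_of_L2 p
        rw [← Submodule.coe_norm] at h
        exact (sq_eq_sq₀ (norm_nonneg _) (norm_nonneg _)).1 (h.trans h2.symm) }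
    (fun z => by
      have h : z - (inner ℂ w z : ℂ) • w ∈ Horiz w := by
        rw [Submodule.mem_orthogonal_singleton_iff_inner_right, inner_sub_right, inner_smul_right,
          inner_self_eq_norm_sq_to_K, hw]
        simp
      exact ⟨WithLp.toLp 2 ((inner ℂ w z : ℂ), ⟨_, h⟩), add_sub_cancel _ _⟩)

theorem measurePreserving_split {w : Cn N} (hw : ‖w‖ = 1) :
    MeasurePreserving (fun p : ℂ × Horiz w => p.1 • w + (p.2 : Cn N))
      ((volume : Measure ℂ).prod (lebesgue (Horiz w))) (lebesgue (Cn N)) := by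
  let _ : InnerProductSpace ℝ (Horiz w) := InnerProductSpace.rclikeToReal ℂ (Horiz w)
  let _ : InnerProductSpace ℝ (Cn N) := InnerProductSpace.rclikeToReal ℂ (Cn N)
  have h1 := (WithLp.volume_preserving_symm_measurableEquiv_toLp_prod ℂ (Horiz w)).symm
  have h2 := (splitIsometry hw).measurePreserving
  exact h2.comp h1

theorem lintegral_Ioi_mul_comp (g : ℝ → ℝ≥0∞) (a : ℝ) :
    ∫⁻ ρ in Set.Ioi (0 : ℝ), ENNReal.ofReal ρ * g ρ =
      ∫⁻ q in Set.Ioi a, ENNReal.ofReal (1 / 2) * g √(q - a) := by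
  have him : (fun ρ : ℝ => ρ ^ 2 + a) '' Set.Ioi 0 = Set.Ioi a := by
    ext q
    constructor
    · rintro ⟨ρ, hρ, rfl⟩
      have : 0 < ρ ^ 2 := pow_pos hρ 2
      simpa using this
    · intro hq
      have hq' : 0 < q - a := sub_pos.2 hq
      exact ⟨√(q - a), Real.sqrt_pos.2 hq', by simp [Real.sq_sqrt hq'.le]⟩
  have hinj : Set.InjOn (fun ρ : ℝ => ρ ^ 2 + a) (Set.Ioi 0) := by
    intro x hx y hy h
    have h' : x ^ 2 = y ^ 2 := add_right_cancel h
    exact (sq_eq_sq₀ (le_of_lt hx) (le_of_lt hy)).1 h'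
  have hd : ∀ x ∈ Set.Ioi (0 : ℝ), HasDerivWithinAt (fun ρ : ℝ => ρ ^ 2 + a) (2 * x) (Set.Ioi 0) x :=
    fun x _ => by
      have := ((hasDerivAt_pow 2 x).add_const a).hasDerivWithinAt (s := Set.Ioi 0)
      simpa using this
  have := lintegral_image_eq_lintegral_abs_deriv_mul measurableSet_Ioi hd hinj
    (fun q => ENNReal.ofReal (1 / 2) * g √(q - a))
  rw [him] at this
  rw [this]
  refine setLIntegral_congr_fun measurableSet_Ioi fun ρ hρ => ?_
  have hρ0 : 0 < ρ := hρ
  simp only [add_sub_cancel_right, Real.sqrt_sq hρ0.le]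
  rw [← mul_assoc, ← ENNReal.ofReal_mul (abs_nonneg _), abs_of_pos (by positivity)]
  congr 2
  ring

theorem finrank_horiz {w : Cn N} (hw : ‖w‖ = 1) : Module.finrank ℝ (Horiz w) = 2 * (N - 1) := by
  have hw0 : w ≠ 0 := by rintro rfl; simp at hw
  have h := Submodule.finrank_add_finrank_orthogonal (Submodule.span ℂ {w})
  rw [finrank_span_singleton hw0, finrank_euclideanSpace_fin] at h
  have h2 : Module.finrank ℂ (Horiz w) = N - 1 := by
    change Module.finrank ℂ ((Submodule.span ℂ {w})ᗮ : Submodule ℂ (Cn N)) = N - 1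
    omega
  rw [← h2, ← Module.finrank_mul_finrank ℝ ℂ (Horiz w), Complex.finrank_real_complex]

theorem lintegral_comp_smul_horiz {w : Cn N} (hw : ‖w‖ = 1) {g : Horiz w → ℝ≥0∞}
    (hg : Measurable g) {q : ℝ} (hq : 0 < q) :
    ∫⁻ ζ, g ζ ∂lebesgue (Horiz w) =
      ENNReal.ofReal (q ^ (N - 1)) * ∫⁻ η, g ((√q : ℝ) • η) ∂lebesgue (Horiz w) := by
  have hs : √q ≠ 0 := (Real.sqrt_pos.2 hq).ne'
  have h := Measure.map_addHaar_smul (lebesgue (Horiz w)) hs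
  rw [← lintegral_map (μ := lebesgue (Horiz w)) hg (measurable_const_smul √q), h,
    lintegral_smul_measure, smul_eq_mul, ← mul_assoc, ← ENNReal.ofReal_mul (by positivity),
    finrank_horiz hw, pow_mul, Real.sq_sqrt hq.le, abs_of_pos (by positivity),
    mul_inv_cancel₀ (by positivity), ENNReal.ofReal_one, one_mul]

/-- The parametrization of the unit sphere by the angle and the horizontal coordinate. -/
def hopfChart (w : Cn N) (θ : ℝ) (η : Horiz w) : Cn N :=
  ((√(1 - ‖η‖ ^ 2) : ℂ) * Complex.exp (Complex.I * θ)) • w + (η : Cn N)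

theorem continuous_hopfChart (w : Cn N) :
    Continuous fun p : ℝ × Horiz w => hopfChart w p.1 p.2 := by
  unfold hopfChart; fun_prop

theorem norm_hopfChart {w : Cn N} (hw : ‖w‖ = 1) (θ : ℝ) {η : Horiz w} (hη : ‖η‖ ≤ 1) :
    ‖hopfChart w θ η‖ = 1 := by
  have h := norm_smul_add_smul_sq hw (inner_horiz η)
    ((√(1 - ‖η‖ ^ 2) : ℂ) * Complex.exp (Complex.I * θ)) 1
  have h1 : 0 ≤ 1 - ‖η‖ ^ 2 := by nlinarith [norm_nonneg η]
  rw [one_smul, norm_mul, norm_cexp_I_mul, Complex.norm_real,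
    Real.norm_of_nonneg (Real.sqrt_nonneg _), mul_one, Real.sq_sqrt h1, norm_one,
    Submodule.norm_coe] at h
  have h2 : ‖hopfChart w θ η‖ ^ 2 = 1 := by rw [hopfChart, h]; ring
  exact (sq_eq_sq₀ (norm_nonneg _) zero_le_one).1 (h2.trans (one_pow 2).symm)

/-- Write z = ρe^{iθ}w + ζ. Replacing ρ by q = ρ² + |ζ|² = |z|² turns ρ dρ into dq/2, and ζ = √q η
contributes q^{N-1}. No density in (θ, η) is left. -/
theorem lintegral_eq_lintegral_hopfChart {w : Cn N} (hw : ‖w‖ = 1) {f : Cn N → ℝ≥0∞}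
    (hf : Measurable f) :
    ∫⁻ z, f z ∂lebesgue (Cn N) = ∫⁻ q in Set.Ioi (0 : ℝ), ENNReal.ofReal (q ^ (N - 1) / 2) *
      ∫⁻ θ in Set.Ioo (-Real.pi) Real.pi, ∫⁻ η in Metric.ball (0 : Horiz w) 1,
        f ((√q : ℝ) • hopfChart w θ η) ∂lebesgue (Horiz w) := by
  -- The indicator of q > |ζ|² encodes ρ > 0 and leaves the range of q independent of ζ, so that the
  -- integrals can be exchanged.
  set G : Horiz w → ℝ → ℝ → ℝ≥0∞ := fun ζ θ q =>
    (Set.Ioi (‖ζ‖ ^ 2)).indicator (fun q => ENNReal.ofReal (1 / 2) *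
      f (((√(q - ‖ζ‖ ^ 2) : ℂ) * Complex.exp (Complex.I * θ)) • w + (ζ : Cn N))) q with hG
  have hGm : Measurable fun p : (Horiz w × ℝ) × ℝ => G p.1.1 p.1.2 p.2 := by
    have : (fun p : (Horiz w × ℝ) × ℝ => G p.1.1 p.1.2 p.2) =
        {p : (Horiz w × ℝ) × ℝ | ‖p.1.1‖ ^ 2 < p.2}.indicator (fun p => ENNReal.ofReal (1 / 2) *
          f (((√(p.2 - ‖p.1.1‖ ^ 2) : ℂ) * Complex.exp (Complex.I * p.1.2)) • w +
            (p.1.1 : Cn N))) := rfl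
    rw [this]
    refine Measurable.indicator (Measurable.const_mul (hf.comp ?_) _)
      (measurableSet_lt (by fun_prop) (by fun_prop))
    exact Continuous.measurable (by fun_prop)
  have hinner (ζ : Horiz w) : ∫⁻ a : ℂ, f (a • w + (ζ : Cn N)) =
      ∫⁻ θ in Set.Ioo (-Real.pi) Real.pi, ∫⁻ q, G ζ θ q := by
    have hm : Measurable fun a : ℂ => f (a • w + (ζ : Cn N)) :=
      hf.comp (Continuous.measurable (by fun_prop))
    rw [← Complex.lintegral_comp_polarCoord_symm]
    have ht : polarCoord.target = Set.Ioi (0 : ℝ) ×ˢ Set.Ioo (-Real.pi) Real.pi := rfl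
    rw [ht, Measure.volume_eq_prod, ← Measure.prod_restrict, lintegral_prod_symm]
    · refine lintegral_congr fun θ => ?_
      have h1 := lintegral_Ioi_mul_comp (fun ρ : ℝ =>
        f (((ρ : ℂ) * Complex.exp (Complex.I * θ)) • w + (ζ : Cn N))) (‖ζ‖ ^ 2)
      rw [hG]
      simp only
      rw [lintegral_indicator measurableSet_Ioi, ← h1]
      refine lintegral_congr fun ρ => ?_
      rw [Complex.polarCoord_symm_apply, mul_comm Complex.I, Complex.exp_mul_I, smul_eq_mul,
        Complex.ofReal_cos, Complex.ofReal_sin]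
    · refine Measurable.aemeasurable ?_
      simp only [Complex.polarCoord_symm_apply, smul_eq_mul]
      exact (ENNReal.measurable_ofReal.comp measurable_fst).mul
        (hm.comp (Continuous.measurable (by fun_prop)))
  have hpos (ζ : Horiz w) (θ q : ℝ) (hq : q ∉ Set.Ioi (0 : ℝ)) : G ζ θ q = 0 := by
    rw [hG]
    refine Set.indicator_of_notMem (fun h => hq ?_) _
    exact (sq_nonneg ‖ζ‖).trans_lt h
  have hscale (q : ℝ) (hq : 0 < q) (θ : ℝ) : ∫⁻ ζ, G ζ θ q ∂lebesgue (Horiz w) =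
      ENNReal.ofReal (q ^ (N - 1) / 2) * ∫⁻ η in Metric.ball (0 : Horiz w) 1,
        f ((√q : ℝ) • hopfChart w θ η) ∂lebesgue (Horiz w) := by
    have hm : Measurable fun ζ => G ζ θ q :=
      hGm.comp (f := fun p : (Horiz w × ℝ) × ℝ => (p.1, p.2)) (by fun_prop) |>.comp
        (f := fun ζ : Horiz w => ((ζ, θ), q)) (by fun_prop)
    rw [lintegral_comp_smul_horiz hw hm hq, div_eq_mul_one_div, ENNReal.ofReal_mul (by positivity),
      mul_assoc]
    congr 1
    have hm2 : Measurable fun η : Horiz w => f ((√q : ℝ) • hopfChart w θ η) :=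
      hf.comp (Continuous.measurable (by unfold hopfChart; fun_prop))
    rw [← lintegral_const_mul _ hm2, ← lintegral_indicator Metric.isOpen_ball.measurableSet]
    refine lintegral_congr fun η => ?_
    have hsq : ‖(√q : ℝ) • η‖ ^ 2 = q * ‖η‖ ^ 2 := by
      rw [norm_smul, Real.norm_of_nonneg (Real.sqrt_nonneg _), mul_pow, Real.sq_sqrt hq.le]
    by_cases hη : ‖η‖ < 1
    · have h1 : q ∈ Set.Ioi (‖(√q : ℝ) • η‖ ^ 2) := by
        rw [Set.mem_Ioi, hsq]
        exact mul_lt_of_lt_one_right hq (pow_lt_one₀ (norm_nonneg _) hη two_ne_zero)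
      rw [hG]
      simp only
      rw [Set.indicator_of_mem h1, Set.indicator_of_mem (by simpa using hη), hsq, hopfChart,
        show q - q * ‖η‖ ^ 2 = q * (1 - ‖η‖ ^ 2) by ring, Real.sqrt_mul hq.le, smul_add,
        Complex.ofReal_mul, mul_assoc, ← smul_smul]
      rfl
    · have h1 : q ∉ Set.Ioi (‖(√q : ℝ) • η‖ ^ 2) := by
        rw [Set.mem_Ioi, hsq, not_lt]
        exact le_mul_of_one_le_right hq.le (one_le_pow₀ (not_lt.1 hη))
      rw [hG]
      simp only
      rw [Set.indicator_of_notMem h1, Set.indicator_of_notMem (by simpa using hη)]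
  have hsplit := measurePreserving_split hw
  rw [← hsplit.lintegral_comp hf, lintegral_prod_symm
    (fun p : ℂ × Horiz w => f (p.1 • w + (p.2 : Cn N))) (hf.comp hsplit.measurable).aemeasurable]
  simp_rw [hinner]
  have hGm1 : Measurable fun p : Horiz w × ℝ => ∫⁻ q, G p.1 p.2 q := hGm.lintegral_prod_right'
  rw [lintegral_lintegral_swap hGm1.aemeasurable]
  have hswap (θ : ℝ) : ∫⁻ ζ, (∫⁻ q, G ζ θ q) ∂lebesgue (Horiz w) =
      ∫⁻ q, ∫⁻ ζ, G ζ θ q ∂lebesgue (Horiz w) := by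
    refine lintegral_lintegral_swap (Measurable.aemeasurable ?_)
    exact hGm.comp (f := fun p : Horiz w × ℝ => ((p.1, θ), p.2)) (by fun_prop)
  simp_rw [hswap]
  have hGm2 : Measurable fun p : ℝ × ℝ => ∫⁻ ζ, G ζ p.1 p.2 ∂lebesgue (Horiz w) := by
    have : Measurable fun p : (ℝ × ℝ) × Horiz w => G p.2 p.1.1 p.1.2 :=
      hGm.comp (f := fun p : (ℝ × ℝ) × Horiz w => ((p.2, p.1.1), p.1.2)) (by fun_prop)
    exact this.lintegral_prod_right'
  rw [lintegral_lintegral_swap hGm2.aemeasurable]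
  rw [← lintegral_indicator measurableSet_Ioi]
  refine lintegral_congr fun q => ?_
  by_cases hq : q ∈ Set.Ioi (0 : ℝ)
  · rw [Set.indicator_of_mem hq]
    simp_rw [hscale q hq]
    refine lintegral_const_mul _ ?_
    have : Measurable fun p : ℝ × Horiz w => f ((√q : ℝ) • hopfChart w p.1 p.2) :=
      hf.comp (((continuous_hopfChart w).const_smul √q).measurable)
    exact this.lintegral_prod_right'
  · rw [Set.indicator_of_notMem hq]
    simp [hpos _ _ _ hq]

end Split

/-! ### Surface measure of the sphere -/

section Sphere

variable {N : ℕ}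

theorem lintegral_Ioo_pow_div_two (hN : N ≠ 0) :
    ∫⁻ q in Set.Ioo (0 : ℝ) 1, ENNReal.ofReal (q ^ (N - 1) / 2) =
      ENNReal.ofReal (1 / (2 * N)) := by
  have hint : IntegrableOn (fun q : ℝ => q ^ (N - 1) / 2) (Set.Ioc 0 1) := by
    rw [← intervalIntegrable_iff_integrableOn_Ioc_of_le zero_le_one]
    exact Continuous.intervalIntegrable (by fun_prop) _ _
  rw [restrict_Ioo_eq_restrict_Ioc, ← ofReal_integral_eq_lintegral_ofReal hint
    ((ae_restrict_iff' measurableSet_Ioc).2 (Filter.Eventually.of_forall fun q hq => by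
      have : 0 < q := hq.1
      positivity)), ← intervalIntegral.integral_of_le zero_le_one,
    intervalIntegral.integral_div, integral_pow]
  congr 1
  obtain ⟨n, rfl⟩ := Nat.exists_eq_succ_of_ne_zero hN
  simp
  ring

theorem ne_zero_of_norm_eq_one {w : Cn N} (hw : ‖w‖ = 1) : N ≠ 0 := by
  rintro rfl
  rw [Subsingleton.elim w 0, norm_zero] at hw
  exact zero_ne_one hw

/-- `toSphere` measures E by the real dimension 2N times the volume of the cone over E in the unit
ball. In the adapted coordinates that cone is {q < 1} times the chart preimage of E, and ∫₀¹
q^{N-1}/2 dq = 1/(2N) cancels the dimension. -/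
theorem map_toSphere_eq_map_hopfChart {w : Cn N} (hw : ‖w‖ = 1) :
    (lebesgue (Cn N)).toSphere.map (Subtype.val : Sph N → Cn N) =
      ((volume.restrict (Set.Ioo (-Real.pi) Real.pi)).prod
        ((lebesgue (Horiz w)).restrict (Metric.ball 0 1))).map
        (fun p => hopfChart w p.1 p.2) := by
  have hN := ne_zero_of_norm_eq_one hw
  ext E hE
  have hΦ := (continuous_hopfChart w).measurable
  rw [Measure.map_apply measurable_subtype_coe hE,
    Measure.toSphere_apply' _ (measurable_subtype_coe hE), Measure.map_apply hΦ hE]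
  set S : Set (Cn N) := {z | 0 < ‖z‖} ∩ {z | ‖z‖ < 1} ∩ (fun z : Cn N => ‖z‖⁻¹ • z) ⁻¹' E with hS
  have hSm : MeasurableSet S :=
    ((measurableSet_lt measurable_const measurable_norm).inter
      (measurableSet_lt measurable_norm measurable_const)).inter
      ((measurable_norm.inv.smul measurable_id) hE)
  have hSeq : Set.Ioo (0 : ℝ) 1 • (Subtype.val '' ((Subtype.val : Sph N → Cn N) ⁻¹' E)) = S := by
    ext z
    rw [Set.mem_smul]
    constructor
    · rintro ⟨ρ, hρ, _, ⟨x, hx, rfl⟩, rfl⟩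
      have hn : ‖ρ • (x : Cn N)‖ = ρ := by
        rw [norm_smul, Real.norm_of_nonneg hρ.1.le, mem_sphere_zero_iff_norm.1 x.2, mul_one]
      refine ⟨⟨by rw [Set.mem_ofPred_eq, hn]; exact hρ.1,
        by rw [Set.mem_ofPred_eq, hn]; exact hρ.2⟩, ?_⟩
      rw [Set.mem_preimage, hn, smul_smul, inv_mul_cancel₀ hρ.1.ne', one_smul]
      exact hx
    · rintro ⟨⟨h0, h1⟩, h2⟩
      have h0' : ‖z‖ ≠ 0 := ne_of_gt h0
      refine ⟨‖z‖, ⟨h0, h1⟩, ‖z‖⁻¹ • z, ⟨⟨‖z‖⁻¹ • z, ?_⟩, h2, rfl⟩, ?_⟩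
      · rw [mem_sphere_zero_iff_norm, norm_smul, norm_inv, norm_norm, inv_mul_cancel₀ h0']
      · rw [smul_smul, mul_inv_cancel₀ h0', one_smul]
  have hprod : ((volume.restrict (Set.Ioo (-Real.pi) Real.pi)).prod
      ((lebesgue (Horiz w)).restrict (Metric.ball 0 1))) ((fun p => hopfChart w p.1 p.2) ⁻¹' E) =
      ∫⁻ θ in Set.Ioo (-Real.pi) Real.pi, ∫⁻ η in Metric.ball (0 : Horiz w) 1,
        E.indicator 1 (hopfChart w θ η) ∂lebesgue (Horiz w) := by
    rw [← lintegral_indicator_one (hΦ hE), lintegral_prod]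
    · rfl
    · exact (measurable_one.indicator (hΦ hE)).aemeasurable
  rw [hSeq, hprod, ← lintegral_indicator_one hSm,
    lintegral_eq_lintegral_hopfChart hw (measurable_one.indicator hSm)]
  set ν := ∫⁻ θ in Set.Ioo (-Real.pi) Real.pi, ∫⁻ η in Metric.ball (0 : Horiz w) 1,
        E.indicator 1 (hopfChart w θ η) ∂lebesgue (Horiz w) with hν
  have hcone (q : ℝ) (hq : 0 < q) : ∫⁻ θ in Set.Ioo (-Real.pi) Real.pi,
      ∫⁻ η in Metric.ball (0 : Horiz w) 1, S.indicator 1 ((√q : ℝ) • hopfChart w θ η)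
        ∂lebesgue (Horiz w) = (Set.Iio (1 : ℝ)).indicator (fun _ => ν) q := by
    have hs : 0 < √q := Real.sqrt_pos.2 hq
    have hmem (θ : ℝ) (η : Horiz w) (hη : η ∈ Metric.ball (0 : Horiz w) 1) :
        (√q : ℝ) • hopfChart w θ η ∈ S ↔ q < 1 ∧ hopfChart w θ η ∈ E := by
      have hn : ‖(√q : ℝ) • hopfChart w θ η‖ = √q := by
        rw [norm_smul, Real.norm_of_nonneg hs.le,
          norm_hopfChart hw θ (mem_ball_zero_iff.1 hη).le, mul_one]
      simp only [hS, Set.mem_inter_iff, Set.mem_ofPred_eq, Set.mem_preimage, hn, hs, true_and,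
        smul_smul, inv_mul_cancel₀ hs.ne', one_smul, Real.sqrt_lt' one_pos, one_pow]
    by_cases h1 : q < 1
    · rw [Set.indicator_of_mem (by exact h1), hν]
      refine lintegral_congr fun θ => setLIntegral_congr_fun Metric.isOpen_ball.measurableSet
        fun η hη => ?_
      by_cases h2 : hopfChart w θ η ∈ E
      · rw [Set.indicator_of_mem h2, Set.indicator_of_mem ((hmem θ η hη).2 ⟨h1, h2⟩)]
        rfl
      · rw [Set.indicator_of_notMem h2,
          Set.indicator_of_notMem fun h => h2 ((hmem θ η hη).1 h).2]
    · rw [Set.indicator_of_notMem (by exact h1)]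
      have h0 (θ : ℝ) : ∫⁻ η in Metric.ball (0 : Horiz w) 1,
          S.indicator 1 ((√q : ℝ) • hopfChart w θ η) ∂lebesgue (Horiz w) = 0 := by
        rw [setLIntegral_congr_fun (g := fun _ => 0) Metric.isOpen_ball.measurableSet
          fun η hη => Set.indicator_of_notMem (fun h => h1 ((hmem θ η hη).1 h).1) _]
        simp
      simp [h0]
  have hstep : ∫⁻ q in Set.Ioi (0 : ℝ), ENNReal.ofReal (q ^ (N - 1) / 2) *
      ∫⁻ θ in Set.Ioo (-Real.pi) Real.pi, ∫⁻ η in Metric.ball (0 : Horiz w) 1,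
        S.indicator 1 ((√q : ℝ) • hopfChart w θ η) ∂lebesgue (Horiz w) =
      (∫⁻ q in Set.Ioo (0 : ℝ) 1, ENNReal.ofReal (q ^ (N - 1) / 2)) * ν := by
    rw [setLIntegral_congr_fun (g := (Set.Iio (1 : ℝ)).indicator
      fun q => ENNReal.ofReal (q ^ (N - 1) / 2) * ν) measurableSet_Ioi fun q hq => ?_]
    · rw [setLIntegral_indicator measurableSet_Iio, Set.inter_comm, Set.Ioi_inter_Iio,
        lintegral_mul_const _ (by fun_prop)]
    · rw [hcone q hq]
      by_cases h1 : q < 1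
      · rw [Set.indicator_of_mem (by exact h1), Set.indicator_of_mem (by exact h1)]
      · rw [Set.indicator_of_notMem (by exact h1), Set.indicator_of_notMem (by exact h1), mul_zero]
  have hdim : Module.finrank ℝ (Cn N) = 2 * N := by
    rw [← Module.finrank_mul_finrank ℝ ℂ (Cn N), Complex.finrank_real_complex,
      finrank_euclideanSpace_fin]
  rw [hstep, lintegral_Ioo_pow_div_two hN, hdim, ← mul_assoc]
  have hN0 : (0 : ℝ) < N := by positivity
  have : ((2 * N : ℕ) : ℝ≥0∞) * ENNReal.ofReal (1 / (2 * N)) = 1 := by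
    rw [← ENNReal.ofReal_natCast, ← ENNReal.ofReal_mul (by positivity)]
    push_cast
    rw [mul_one_div_cancel (by positivity), ENNReal.ofReal_one]
  rw [this, one_mul]

/-- Multiplication by `e^{it}` preserves the Lebesgue measure of a complex inner product space. -/
theorem measurePreserving_rotation (H : Type*) [NormedAddCommGroup H] [InnerProductSpace ℂ H]
    [FiniteDimensional ℂ H] [MeasurableSpace H] [BorelSpace H] (t : ℝ) :
    MeasurePreserving (fun v : H => Complex.exp (Complex.I * t) • v) (lebesgue H) (lebesgue H) := by
  let _ : InnerProductSpace ℝ H := InnerProductSpace.rclikeToReal ℂ H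
  let e : H ≃ₗᵢ[ℝ] H :=
    { (LinearEquiv.smulOfNeZero ℂ H _ (Complex.exp_ne_zero (Complex.I * t))).restrictScalars ℝ with
      norm_map' := fun v => by
        change ‖Complex.exp (Complex.I * t) • v‖ = ‖v‖
        rw [norm_smul, norm_cexp_I_mul, one_mul] }
  exact e.measurePreserving

theorem setIntegral_ball_rotation {w : Cn N} (g : Horiz w → ℂ) (t : ℝ) :
    ∫ η in Metric.ball (0 : Horiz w) 1, g (Complex.exp (Complex.I * t) • η) ∂lebesgue (Horiz w) =
      ∫ η in Metric.ball (0 : Horiz w) 1, g η ∂lebesgue (Horiz w) := by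
  have hmp := measurePreserving_rotation (Horiz w) t
  have hemb : MeasurableEmbedding fun v : Horiz w => Complex.exp (Complex.I * t) • v :=
    (Homeomorph.smulOfNeZero _ (Complex.exp_ne_zero (Complex.I * t))).measurableEmbedding
  have := hmp.setIntegral_preimage_emb hemb g (Metric.ball (0 : Horiz w) 1)
  rw [← this]
  congr 2
  ext v
  simp [norm_smul]

theorem integral_toSphere_eq {w : Cn N} (hw : ‖w‖ = 1) {F : Cn N → ℂ} (hF : Continuous F)
    (hinv : ∀ (t : ℝ) (z : Cn N), F (Complex.exp (Complex.I * t) • z) = F z) :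
    ∫ z : Sph N, F z ∂(lebesgue (Cn N)).toSphere =
      2 * Real.pi * ∫ η in Metric.ball (0 : Horiz w) 1,
        F ((√(1 - ‖η‖ ^ 2) : ℂ) • w + (η : Cn N)) ∂lebesgue (Horiz w) := by
  have hmap := map_toSphere_eq_map_hopfChart hw
  have hΦ := (continuous_hopfChart w).measurable
  have hint : Integrable (fun z : Sph N => F z) (lebesgue (Cn N)).toSphere := by
    have hc : Continuous fun z : Sph N => F z := hF.comp continuous_subtype_val
    exact hc.integrable_of_hasCompactSupport (HasCompactSupport.of_compactSpace _)
  have hint2 : Integrable F ((lebesgue (Cn N)).toSphere.map (Subtype.val : Sph N → Cn N)) :=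
    (integrable_map_measure hF.aestronglyMeasurable measurable_subtype_coe.aemeasurable).2 hint
  rw [hmap] at hint2
  have hint3 : Integrable (fun p : ℝ × Horiz w => F (hopfChart w p.1 p.2)) _ := (integrable_map_measure hF.aestronglyMeasurable hΦ.aemeasurable).1 hint2
  rw [← integral_map (φ := (Subtype.val : Sph N → Cn N)) measurable_subtype_coe.aemeasurable
    hF.aestronglyMeasurable, hmap, integral_map hΦ.aemeasurable hF.aestronglyMeasurable,
    integral_prod _ hint3]
  -- Replacing η by e^{iθ}η preserves the ball and its measure and makes the chart point e^{iθ}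
  -- times the point with angle zero; invariance of F then removes θ.
  have hθ (θ : ℝ) : ∫ η in Metric.ball (0 : Horiz w) 1, F (hopfChart w θ η) ∂lebesgue (Horiz w) =
      ∫ η in Metric.ball (0 : Horiz w) 1,
        F ((√(1 - ‖η‖ ^ 2) : ℂ) • w + (η : Cn N)) ∂lebesgue (Horiz w) := by
    rw [← setIntegral_ball_rotation (fun η : Horiz w => F (hopfChart w θ η)) θ]
    congr 1
    ext η
    rw [← hinv θ ((√(1 - ‖η‖ ^ 2) : ℂ) • w + (η : Cn N)), hopfChart, norm_smul, norm_cexp_I_mul,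
      one_mul, smul_add, smul_smul, mul_comm (Complex.exp _)]
    rfl
  simp_rw [hθ]
  rw [integral_const, measureReal_restrict_apply_univ, Real.volume_real_Ioo_of_le
    (by linarith [Real.pi_pos]), Complex.real_smul]
  push_cast
  ring

end Sphere

/-! ### Asymptotics of inner products -/

section InnerProduct

variable {N : ℕ} {A B : Matrix (Fin N) (Fin N) ℂ}

/-- The constant is 6 = 3 + 2 + 1: one remainder against the full second factor, the other against
two leading terms, and the product of the two first corrections. The surplus factor G ≤ 1 is
dropped. -/
theorem norm_mul_conj_expansion_le {σ τ I σ' τ' I' : ℂ} {ε C G : ℝ} (hε0 : 0 ≤ ε) (hε1 : ε ≤ 1)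
    (hC : 0 ≤ C) (hG0 : 0 ≤ G) (hG1 : G ≤ 1) (hσ : ‖σ‖ ≤ C * G) (hτ : ‖τ‖ ≤ C * G)
    (hI : ‖I - σ - ε * τ‖ ≤ C * ε ^ 2 * G) (hσ' : ‖σ'‖ ≤ C * G) (hτ' : ‖τ'‖ ≤ C * G)
    (hI' : ‖I' - σ' - ε * τ'‖ ≤ C * ε ^ 2 * G) :
    ‖I * conj I' - σ * conj σ' - ε * (τ * conj σ' + σ * conj τ')‖ ≤ 6 * C ^ 2 * ε ^ 2 * G := by
  set ρ := I - σ - ε * τ with hρ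
  set ρ' := I' - σ' - ε * τ' with hρ'
  have hCG : 0 ≤ C * G := by positivity
  have hετ (x : ℂ) (hx : ‖x‖ ≤ C * G) : ‖(ε : ℂ) * x‖ ≤ C * G := by
    rw [norm_mul, Complex.norm_real, Real.norm_of_nonneg hε0]
    exact (mul_le_of_le_one_left (norm_nonneg _) hε1).trans hx
  have ha : ‖σ + ε * τ‖ ≤ 2 * (C * G) :=
    (norm_add_le _ _).trans (by linarith [hετ τ hτ])
  have hε2 : ε ^ 2 ≤ 1 := pow_le_one₀ hε0 hε1
  have hIn : ‖I'‖ ≤ 3 * (C * G) := by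
    have e : I' = σ' + ε * τ' + ρ' := by rw [hρ']; ring
    have h1 := norm_add_le (σ' + ε * τ') ρ'
    have h2 := norm_add_le σ' (ε * τ')
    have h3 : C * ε ^ 2 * G ≤ C * G := by
      rw [mul_right_comm]; exact mul_le_of_le_one_right hCG hε2
    rw [e]
    linarith [hετ τ' hτ']
  have e : I * conj I' - σ * conj σ' - ε * (τ * conj σ' + σ * conj τ') =
      ρ * conj I' + (σ + ε * τ) * conj ρ' + (ε : ℂ) ^ 2 * (τ * conj τ') := by
    rw [hρ, hρ']
    simp only [map_sub, map_mul, Complex.conj_ofReal]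
    ring
  rw [e]
  have n1 : ‖ρ * conj I'‖ ≤ C * ε ^ 2 * G * (3 * (C * G)) := by
    rw [norm_mul, Complex.norm_conj]; gcongr
  have n2 : ‖(σ + ε * τ) * conj ρ'‖ ≤ 2 * (C * G) * (C * ε ^ 2 * G) := by
    rw [norm_mul, Complex.norm_conj]; gcongr
  have n3 : ‖(ε : ℂ) ^ 2 * (τ * conj τ')‖ ≤ ε ^ 2 * (C * G * (C * G)) := by
    rw [norm_mul, norm_mul, norm_pow, Complex.norm_conj, Complex.norm_real,
      Real.norm_of_nonneg hε0]
    gcongr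
  calc _ ≤ C * ε ^ 2 * G * (3 * (C * G)) + 2 * (C * G) * (C * ε ^ 2 * G) +
        ε ^ 2 * (C * G * (C * G)) :=
        (norm_add_le _ _).trans (add_le_add ((norm_add_le _ _).trans (add_le_add n1 n2)) n3)
    _ = 6 * C ^ 2 * ε ^ 2 * G * G := by ring
    _ ≤ _ := mul_le_of_le_one_right (by positivity) hG1

theorem exists_common_state_expansion (hA : A ∈ disk N) (hB : B ∈ disk N) {w : Cn N}
    (hw : ‖w‖ = 1) :
    ∃ C b : ℝ, 0 ≤ C ∧ 0 < b ∧ ∀ M : Matrix (Fin N) (Fin N) ℂ, M = A ∨ M = B →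
      ∀ u : Cn N, inner ℂ w u = 0 →
      ‖symbol M w u‖ ≤ C * Real.exp (-(b * ‖u‖ ^ 2)) ∧
      ‖symbolOne M w u‖ ≤ C * Real.exp (-(b * ‖u‖ ^ 2)) ∧
      ∀ k : ℕ, k ≠ 0 → ‖u‖ ≤ √(k : ℝ) →
        ‖√(k : ℝ) * reducedState k M w (spherePoint k w u) - symbol M w u -
          (√(k : ℝ))⁻¹ * symbolOne M w u‖ ≤ C * (k : ℝ)⁻¹ * Real.exp (-(b * ‖u‖ ^ 2)) := by
  obtain ⟨C1, b1, hC1, hb1, h1⟩ := exists_state_expansion hA hw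
  obtain ⟨C2, b2, hC2, hb2, h2⟩ := exists_state_expansion hB hw
  have mono {C b : ℝ} (hC : C ≤ max C1 C2) (hb : min b1 b2 ≤ b) (x c : ℝ) (hx : 0 ≤ x)
      (hc : 0 ≤ c) :
      C * c * Real.exp (-(b * x)) ≤ max C1 C2 * c * Real.exp (-(min b1 b2 * x)) := by
    have : 0 ≤ max C1 C2 := hC1.trans (le_max_left _ _)
    gcongr
  have mono1 {C b : ℝ} (hC : C ≤ max C1 C2) (hb : min b1 b2 ≤ b) (x : ℝ) (hx : 0 ≤ x) :
      C * Real.exp (-(b * x)) ≤ max C1 C2 * Real.exp (-(min b1 b2 * x)) := by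
    simpa using mono hC hb x 1 hx zero_le_one
  refine ⟨max C1 C2, min b1 b2, hC1.trans (le_max_left _ _), lt_min hb1 hb2, ?_⟩
  rintro M (rfl | rfl) u hu
  · obtain ⟨i, j, l⟩ := h1 u hu
    have hC := le_max_left C1 C2
    have hb := min_le_left b1 b2
    exact ⟨i.trans (mono1 hC hb _ (by positivity)), j.trans (mono1 hC hb _ (by positivity)),
      fun k hk huk => (l k hk huk).trans (mono hC hb _ _ (by positivity) (by positivity))⟩
  · obtain ⟨i, j, l⟩ := h2 u hu
    have hC := le_max_right C1 C2
    have hb := min_le_right b1 b2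
    exact ⟨i.trans (mono1 hC hb _ (by positivity)), j.trans (mono1 hC hb _ (by positivity)),
      fun k hk huk => (l k hk huk).trans (mono hC hb _ _ (by positivity) (by positivity))⟩

theorem integrable_symbol_mul_conj (hA : A ∈ disk N) (hB : B ∈ disk N) {w : Cn N} (hw : ‖w‖ = 1) :
    Integrable (fun η : Horiz w => symbol A w η * conj (symbol B w η)) (lebesgue (Horiz w)) := by
  obtain ⟨C, b, hC, hb, h⟩ := exists_common_state_expansion hA hB hw
  have hm (M : Matrix (Fin N) (Fin N) ℂ) : Measurable fun η : Horiz w => symbol M w η :=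
    (stronglyMeasurable_symbol w).measurable.comp measurable_subtype_coe
  refine ((integrable_gaussian (Horiz w) hb).const_mul (C * C)).mono'
    ((hm A).mul (Complex.continuous_conj.measurable.comp (hm B))).aestronglyMeasurable
    (Filter.Eventually.of_forall fun η => ?_)
  have h1 := (h A (Or.inl rfl) η (inner_horiz η)).1
  have h2 := (h B (Or.inr rfl) η (inner_horiz η)).1
  rw [Submodule.norm_coe] at h1 h2
  have hG1 : Real.exp (-(b * ‖η‖ ^ 2)) ≤ 1 := Real.exp_le_one_iff.2 (by
    rw [neg_nonpos]; positivity)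
  rw [norm_mul, Complex.norm_conj]
  calc _ ≤ C * Real.exp (-(b * ‖η‖ ^ 2)) * (C * 1) := by
        gcongr
        exact h2.trans (by gcongr)
    _ = _ := by ring

theorem sphereInner_reducedState (A B : Matrix (Fin N) (Fin N) ℂ) {w : Cn N} (hw : ‖w‖ = 1)
    {k : ℕ} (hk : k ≠ 0) :
    sphereInner (fun z : Sph N => reducedState k A w z) (fun z : Sph N => reducedState k B w z) =
      2 * Real.pi / (k : ℂ) ^ N * ∫ u in Metric.ball (0 : Horiz w) √(k : ℝ),
        (√(k : ℝ) * reducedState k A w (spherePoint k w u)) *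
          conj (√(k : ℝ) * reducedState k B w (spherePoint k w u)) ∂lebesgue (Horiz w) := by
  set F : Cn N → ℂ := fun z => reducedState k A w z * conj (reducedState k B w z) with hF
  have hFc : Continuous F :=
    (continuous_reducedState k w).mul (Complex.continuous_conj.comp (continuous_reducedState k w))
  have hinv (t : ℝ) (z : Cn N) : F (Complex.exp (Complex.I * t) • z) = F z := by
    have h1 : Complex.exp (Complex.I * k * t) * conj (Complex.exp (Complex.I * k * t)) = 1 := by
      rw [Complex.mul_conj, Complex.normSq_eq_norm_sq]
      have := norm_cexp_I_mul (k * t)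
      rw [show Complex.I * ((k * t : ℝ) : ℂ) = Complex.I * k * t by push_cast; ring] at this
      rw [this]; simp
    simp only [hF, reducedState, reduction_rotate, map_mul]
    rw [mul_mul_mul_comm, h1, one_mul]
  have hs : 0 < √(k : ℝ) := by positivity
  have hkr : (0 : ℝ) < k := by positivity
  have hscale := Measure.setIntegral_comp_smul_of_pos (lebesgue (Horiz w))
    (fun η : Horiz w => F ((√(1 - ‖η‖ ^ 2) : ℂ) • w + (η : Cn N)))
    (Metric.ball (0 : Horiz w) √(k : ℝ)) (inv_pos.2 hs)
  rw [smul_ball (inv_ne_zero hs.ne'), smul_zero, norm_inv, Real.norm_of_nonneg hs.le,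
    inv_mul_cancel₀ hs.ne', finrank_horiz hw, pow_mul, inv_pow, Real.sq_sqrt hkr.le,
    inv_pow, inv_inv] at hscale
  have hint := integral_toSphere_eq hw hFc hinv
  have hpt (u : Horiz w) : (√(k : ℝ) * reducedState k A w (spherePoint k w u)) *
      conj (√(k : ℝ) * reducedState k B w (spherePoint k w u)) =
      (k : ℂ) * F ((√(1 - ‖(√(k : ℝ))⁻¹ • u‖ ^ 2) : ℂ) • w +
        (((√(k : ℝ))⁻¹ • u : Horiz w) : Cn N)) := by
    have hk2 : (k : ℂ) = (√(k : ℝ) : ℂ) * (√(k : ℝ) : ℂ) := by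
      rw [← Complex.ofReal_mul, Real.mul_self_sqrt hkr.le]; simp
    have hsp : (√(1 - ‖(√(k : ℝ))⁻¹ • u‖ ^ 2) : ℂ) • w +
        (((√(k : ℝ))⁻¹ • u : Horiz w) : Cn N) = spherePoint k w u := by
      rw [spherePoint, norm_smul, norm_inv, Real.norm_of_nonneg hs.le, Submodule.norm_coe,
        ← Complex.ofReal_inv, Complex.coe_smul]
      rfl
    rw [hsp, hF, hk2]
    simp only [map_mul, Complex.conj_ofReal]
    ring
  simp_rw [hpt]
  rw [integral_const_mul, hscale, Complex.real_smul]
  refine hint.trans ?_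
  -- The dilation accounts for k^{N-1} and the two factors √k for k. Writing N = n + 1 resolves the
  -- truncated subtraction.
  obtain ⟨n, rfl⟩ := Nat.exists_eq_succ_of_ne_zero (ne_zero_of_norm_eq_one hw)
  have hk0 : (k : ℂ) ≠ 0 := by exact_mod_cast hk
  rw [Nat.succ_sub_one, pow_succ]
  push_cast
  field_simp

/-- The integrand is expanded to first order in k^{-1/2} with a Gaussian error of order k⁻¹, and the
first-order term T integrates to zero because it is odd. -/
theorem exists_norm_integral_sub_le (hA : A ∈ disk N) (hB : B ∈ disk N) {w : Cn N} (hw : ‖w‖ = 1) :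
    ∃ C : ℝ, ∀ k : ℕ, k ≠ 0 → ‖(∫ u in Metric.ball (0 : Horiz w) √(k : ℝ),
        (√(k : ℝ) * reducedState k A w (spherePoint k w u)) *
          conj (√(k : ℝ) * reducedState k B w (spherePoint k w u)) ∂lebesgue (Horiz w)) -
        ∫ η : Horiz w, symbol A w η * conj (symbol B w η) ∂lebesgue (Horiz w)‖ ≤
      C * (k : ℝ)⁻¹ := by
  obtain ⟨C, b, hC, hb, h⟩ := exists_common_state_expansion hA hB hw
  obtain ⟨C1, hC1, h1⟩ := exists_pow_mul_exp_le 1 hb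
  have hm0 (M : Matrix (Fin N) (Fin N) ℂ) : Measurable fun η : Horiz w => symbol M w η :=
    (stronglyMeasurable_symbol w).measurable.comp measurable_subtype_coe
  have hm1 (M : Matrix (Fin N) (Fin N) ℂ) : Measurable fun η : Horiz w => symbolOne M w η :=
    (stronglyMeasurable_symbolOne w).measurable.comp measurable_subtype_coe
  set T : Horiz w → ℂ := fun u => symbolOne A w u * conj (symbol B w u) +
    symbol A w u * conj (symbolOne B w u) with hT
  have hTm : Measurable T :=
    ((hm1 A).mul (Complex.continuous_conj.measurable.comp (hm0 B))).add
      ((hm0 A).mul (Complex.continuous_conj.measurable.comp (hm1 B)))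
  have hG1 (u : Horiz w) : Real.exp (-(b * ‖u‖ ^ 2)) ≤ 1 := Real.exp_le_one_iff.2 (by
    rw [neg_nonpos]; positivity)
  have hσA (u : Horiz w) : ‖symbol A w u‖ ≤ C * Real.exp (-(b * ‖u‖ ^ 2)) :=
    (h A (Or.inl rfl) u (inner_horiz u)).1
  have hσB (u : Horiz w) : ‖symbol B w u‖ ≤ C * Real.exp (-(b * ‖u‖ ^ 2)) :=
    (h B (Or.inr rfl) u (inner_horiz u)).1
  have hτA (u : Horiz w) : ‖symbolOne A w u‖ ≤ C * Real.exp (-(b * ‖u‖ ^ 2)) :=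
    (h A (Or.inl rfl) u (inner_horiz u)).2.1
  have hτB (u : Horiz w) : ‖symbolOne B w u‖ ≤ C * Real.exp (-(b * ‖u‖ ^ 2)) :=
    (h B (Or.inr rfl) u (inner_horiz u)).2.1
  have hprod {x y : ℂ} {u : Horiz w} (hx : ‖x‖ ≤ C * Real.exp (-(b * ‖u‖ ^ 2)))
      (hy : ‖y‖ ≤ C * Real.exp (-(b * ‖u‖ ^ 2))) :
      ‖x * conj y‖ ≤ C ^ 2 * Real.exp (-(b * ‖u‖ ^ 2)) := by
    rw [norm_mul, Complex.norm_conj]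
    calc _ ≤ C * Real.exp (-(b * ‖u‖ ^ 2)) * (C * 1) := by
          gcongr
          exact hy.trans (mul_le_mul_of_nonneg_left (hG1 u) hC)
      _ = _ := by ring
  have hTn (u : Horiz w) : ‖T u‖ ≤ 2 * C ^ 2 * Real.exp (-(b * ‖u‖ ^ 2)) := by
    refine (norm_add_le _ _).trans ?_
    linarith [hprod (hτA u) (hσB u), hprod (hσA u) (hτB u)]
  have hTi : Integrable T (lebesgue (Horiz w)) :=
    ((integrable_gaussian (Horiz w) hb).const_mul (2 * C ^ 2)).mono' hTm.aestronglyMeasurable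
      (Filter.Eventually.of_forall hTn)
  have hT0 : ∫ u, T u ∂lebesgue (Horiz w) = 0 := by
    have h2 := integral_neg_eq_self T (lebesgue (Horiz w))
    have h3 (u : Horiz w) : T (-u) = -T u := by
      simp only [hT, Submodule.coe_neg, symbol_neg, symbolOne_neg, map_neg]
      ring
    simp_rw [h3, integral_neg] at h2
    exact self_eq_neg.1 h2.symm
  have hSi := integrable_symbol_mul_conj hA hB hw
  have hgi := integrable_gaussian (Horiz w) (half_pos hb)
  set J : ℝ := ∫ u, Real.exp (-(b / 2 * ‖u‖ ^ 2)) ∂lebesgue (Horiz w) with hJ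
  -- The first summand serves inside the ball of radius √k. Outside it |u|²/k ≥ 1 is inserted, and
  -- C1 is the cost of absorbing |u|² into half of the Gaussian.
  refine ⟨(6 * C ^ 2 + 3 * C ^ 2 * C1) * J, fun k hk => ?_⟩
  have hs : 0 < √(k : ℝ) := by positivity
  have hkr : (0 : ℝ) < k := by positivity
  set ε : ℝ := (√(k : ℝ))⁻¹ with hε
  have hε0 : 0 < ε := inv_pos.2 hs
  have hε1 : ε ≤ 1 := inv_le_one_of_one_le₀ (Real.one_le_sqrt.2 (by
    exact_mod_cast Nat.one_le_iff_ne_zero.2 hk))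
  have hεk : (k : ℝ)⁻¹ = ε ^ 2 := by rw [hε, inv_pow, Real.sq_sqrt hkr.le]
  set P : Horiz w → ℂ := fun u => (√(k : ℝ) * reducedState k A w (spherePoint k w u)) *
          conj (√(k : ℝ) * reducedState k B w (spherePoint k w u)) with hP
  have hPc : Continuous P := by
    have hsp : Continuous fun u : Horiz w => spherePoint k w (u : Cn N) := by
      unfold spherePoint; fun_prop
    exact (continuous_const.mul ((continuous_reducedState k w).comp hsp)).mul
      (Complex.continuous_conj.comp
        (continuous_const.mul ((continuous_reducedState k w).comp hsp)))
  have hball : MeasurableSet (Metric.ball (0 : Horiz w) √(k : ℝ)) := Metric.isOpen_ball.measurableSet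
  have hPi : Integrable ((Metric.ball (0 : Horiz w) √(k : ℝ)).indicator P) (lebesgue (Horiz w)) :=
    ((hPc.continuousOn.integrableOn_compact (isCompact_closedBall (0 : Horiz w) √(k : ℝ))).mono_set
      Metric.ball_subset_closedBall).integrable_indicator hball
  have hpt (u : Horiz w) : ‖(Metric.ball (0 : Horiz w) √(k : ℝ)).indicator P u -
      symbol A w u * conj (symbol B w u) - ε * T u‖ ≤
      (6 * C ^ 2 + 3 * C ^ 2 * C1) * ε ^ 2 * Real.exp (-(b / 2 * ‖u‖ ^ 2)) := by
    have hGF : Real.exp (-(b * ‖u‖ ^ 2)) ≤ Real.exp (-(b / 2 * ‖u‖ ^ 2)) := by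
      refine Real.exp_le_exp.2 (neg_le_neg ?_)
      gcongr
      linarith
    by_cases hu : ‖u‖ < √(k : ℝ)
    · rw [Set.indicator_of_mem (by simpa using hu)]
      have hIA := (h A (Or.inl rfl) u (inner_horiz u)).2.2 k hk hu.le
      have hIB := (h B (Or.inr rfl) u (inner_horiz u)).2.2 k hk hu.le
      rw [hεk, Submodule.norm_coe, ← hε] at hIA hIB
      refine (norm_mul_conj_expansion_le hε0.le hε1 hC (Real.exp_pos _).le (hG1 u) (hσA u) (hτA u)
        hIA (hσB u) (hτB u) hIB).trans ?_
      have : 0 ≤ 3 * C ^ 2 * C1 * ε ^ 2 * Real.exp (-(b / 2 * ‖u‖ ^ 2)) := by positivity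
      have h4 : 6 * C ^ 2 * ε ^ 2 * Real.exp (-(b * ‖u‖ ^ 2)) ≤
          6 * C ^ 2 * ε ^ 2 * Real.exp (-(b / 2 * ‖u‖ ^ 2)) := by gcongr
      linarith
    · rw [Set.indicator_of_notMem (by simpa using hu), zero_sub]
      have h5 : 1 ≤ ε ^ 2 * ‖u‖ ^ 2 := by
        rw [← mul_pow]
        refine one_le_pow₀ ?_
        rw [hε, ← div_eq_inv_mul, one_le_div hs]
        exact not_lt.1 hu
      have h6 := h1 (‖u‖ ^ 2) (by positivity)
      rw [pow_one] at h6
      calc _ ≤ ‖symbol A w u * conj (symbol B w u)‖ + ‖(ε : ℂ) * T u‖ := by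
            refine (norm_sub_le _ _).trans (le_of_eq ?_)
            rw [norm_neg]
        _ ≤ C ^ 2 * Real.exp (-(b * ‖u‖ ^ 2)) + 1 * (2 * C ^ 2 * Real.exp (-(b * ‖u‖ ^ 2))) := by
            refine add_le_add (hprod (hσA u) (hσB u)) ?_
            rw [norm_mul, Complex.norm_real, Real.norm_of_nonneg hε0.le]
            gcongr
            exact hTn u
        _ = 3 * C ^ 2 * (1 * Real.exp (-(b * ‖u‖ ^ 2))) := by ring
        _ ≤ 3 * C ^ 2 * (ε ^ 2 * ‖u‖ ^ 2 * Real.exp (-(b * ‖u‖ ^ 2))) := by gcongr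
        _ = 3 * C ^ 2 * ε ^ 2 * (‖u‖ ^ 2 * Real.exp (-(b * ‖u‖ ^ 2))) := by ring
        _ ≤ 3 * C ^ 2 * ε ^ 2 * (C1 * Real.exp (-(b / 2 * ‖u‖ ^ 2))) := by gcongr
        _ ≤ _ := by
          have : 0 ≤ 6 * C ^ 2 * ε ^ 2 * Real.exp (-(b / 2 * ‖u‖ ^ 2)) := by positivity
          linarith
  have hsplit : (∫ u in Metric.ball (0 : Horiz w) √(k : ℝ), P u ∂lebesgue (Horiz w)) -
      ∫ η : Horiz w, symbol A w η * conj (symbol B w η) ∂lebesgue (Horiz w) =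
      ∫ u, ((Metric.ball (0 : Horiz w) √(k : ℝ)).indicator P u -
        symbol A w u * conj (symbol B w u) - ε * T u) ∂lebesgue (Horiz w) := by
    have hi : Integrable (fun u => (Metric.ball (0 : Horiz w) √(k : ℝ)).indicator P u -
        symbol A w u * conj (symbol B w u)) (lebesgue (Horiz w)) := hPi.sub hSi
    rw [integral_sub hi (hTi.const_mul _), integral_sub hPi hSi, integral_const_mul, hT0, mul_zero,
      sub_zero, integral_indicator hball]
  rw [hsplit, hεk]
  refine (norm_integral_le_of_norm_le (hgi.const_mul _)
    (Filter.Eventually.of_forall hpt)).trans_eq ?_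
  rw [integral_const_mul]
  ring

theorem sphereInner_sub_isBigO (hA : A ∈ disk N) (hB : B ∈ disk N) {w : Cn N} (hw : ‖w‖ = 1) :
    (fun k : ℕ => sphereInner (fun z : Sph N => reducedState k A w z)
        (fun z : Sph N => reducedState k B w z) -
          (2 * Real.pi / (k : ℂ) ^ N) *
            ∫ η : Horiz w, symbol A w η * conj (symbol B w η) ∂(lebesgue (Horiz w)))
        =O[atTop] fun k : ℕ => ((k : ℝ) ^ (N + 1))⁻¹ := by
  obtain ⟨C, hC⟩ := exists_norm_integral_sub_le hA hB hw
  refine IsBigO.of_bound (2 * Real.pi * C) ?_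
  filter_upwards [eventually_ne_atTop 0] with k hk
  rw [sphereInner_reducedState A B hw hk, ← mul_sub, norm_mul, norm_div, norm_mul,
    Complex.norm_ofNat, Complex.norm_real, Real.norm_of_nonneg Real.pi_pos.le, norm_pow,
    Complex.norm_natCast, Real.norm_of_nonneg (by positivity)]
  have hk0 : (0 : ℝ) < k := by positivity
  calc _ ≤ 2 * Real.pi / (k : ℝ) ^ N * (C * (k : ℝ)⁻¹) := by
        gcongr
        exact hC k hk
    _ = _ := by rw [pow_succ]; field_simp

end InnerProduct

end ReducedGaussian

end

theorem theorem1p2 (N : ℕ) (A : Matrix (Fin N) (Fin N) ℂ) (hA : A ∈ disk N) (w : Sph N) :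
    -- (1) micro-support: in `ℂ^N`, on the unit sphere, and as a section over `ℂP^{N-1}`
    (microSupport (fun k (z : Cn N) => ‖reducedState k A w z‖) =
        {z | ∃ t ∈ Set.Icc (0 : ℝ) (2 * Real.pi), z = Complex.exp (Complex.I * t) • (w : Cn N)} ∧
      microSupport (fun k (z : Sph N) => ‖reducedState k A w z‖) =
        {z | ∃ t ∈ Set.Icc (0 : ℝ) (2 * Real.pi), z = rotate t w} ∧
      microSupport (fun k (p : CP N) => (reducedSection k A w p).size) = {hopf w}) ∧
    -- (2) the rescaled limit and its closed form
    ((∀ η ∈ Horiz (w : Cn N),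
        Integrable (symbolIntegrand A w η) ∧
        Tendsto (fun k : ℕ => (√(k : ℝ) : ℂ) *
            reducedState k A w ((w : Cn N) + ((√(k : ℝ))⁻¹ : ℂ) • η))
          atTop (𝓝 (symbol A w η))) ∧
      0 < (quad A w + 1).re ∧
      ∃ Q ∈ formDisk (Horiz (w : Cn N)), ∀ η : Horiz (w : Cn N),
        symbol A w η = (1 / √(2 * Real.pi) : ℂ) * (1 / (quad A w + 1) ^ (1 / 2 : ℂ)) *
          Complex.exp (Q η / 2) * Complex.exp (-(‖η‖ : ℂ) ^ 2 / 2)) ∧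
    -- (3) inner products
    (∀ B ∈ disk N,
      Integrable (fun η : Horiz (w : Cn N) => symbol A w η * conj (symbol B w η))
        (lebesgue (Horiz (w : Cn N))) ∧
      (fun k : ℕ => sphereInner (fun z : Sph N => reducedState k A w z) (fun z : Sph N => reducedState k B w z) -
          (2 * Real.pi / (k : ℂ) ^ N) *
            ∫ η : Horiz (w : Cn N), symbol A w η * conj (symbol B w η)
              ∂(lebesgue (Horiz (w : Cn N))))
        =O[atTop] fun k : ℕ => ((k : ℝ) ^ (N + 1))⁻¹) := by
  have hw : ‖(w : Cn N)‖ = 1 := by simp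
  refine ⟨⟨microSupport_reducedState hA hw, microSupport_reducedState_sphere hA w,
    microSupport_reducedSection hA w⟩, ⟨fun η hη => ?_, re_quad_add_one_pos hA hw,
    reducedForm A w, reducedForm_mem_formDisk hA hw, symbol_eq_reducedForm hA hw⟩,
    fun B hB => ⟨integrable_symbol_mul_conj hA hB hw, sphereInner_sub_isBigO hA hB hw⟩⟩
  have hu := Submodule.mem_orthogonal_singleton_iff_inner_right.1 hη
  exact ⟨integrable_symbolIntegrand hA hw hu, tendsto_sqrt_mul_reducedState hA hw hu⟩
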